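/- Let $\mathbb{K}$ be an algebraically closed field of arbitrary characteristic, let $X$ be an irreducible variety over $\mathbb{K}$ (an integral separated scheme of finite type over $\mathbb{K}$) of dimension $d$, and let $n\ge 0$ be an integer. Let $\mathcal{I}_X$ be the ideal sheaf of the diagonal in $X\times_{\mathbb{K}} X$, and let $\mathcal{P}^n_X=\mathcal{O}_{X\times X}/\mathcal{I}_X^{n+1}$ be the sheaf of principal parts of order $n$, an $\mathcal{O}_X$-module through the first projection. Let $G_n:\mathrm{Gr}_{\binom{n+d}{d}}(\mathcal{P}^n_X)\to X$ be the Grassmannian of locally free quotients of $\mathcal{P}^n_X$ of rank $\binom{n+d}{d}$. On the set $U\subseteq X$ of non-singular points $\mathcal{P}^n_X$ is locally free of rank $\binom{n+d}{d}$, so that its identity quotient defines a section $\sigma:U\to \mathrm{Gr}_{\binom{n+d}{d}}(\mathcal{P}^n_X)$ of $G_n$ over $U$. Let $\mathrm{Nash}_n(X)$, the Nash blowup of order $n$ of $X$, be the closure of $\sigma(U)$ with its reduced scheme structure, and let $\pi_n:\mathrm{Nash}_n(X)\to X$ be the restriction of $G_n$. For a commutative $\mathbb{K}$-algebra $R$ let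 $\mathcal{P}^n_{R|\mathbb{K}}=(R\otimes_{\mathbb{K}}R)/I^{n+1}$, where $I$ is the kernel of the multiplication map $R\otimes_{\mathbb{K}}R\to R$, regarded as an $R$-module through the left factor. Suppose that $\pi_n:\mathrm{Nash}_n(X)\to X$ is an isomorphism. Then for every point $x\in X$ there is an isomorphism of $\mathcal{O}_{X,x}$-modules $$\mathcal{P}^n_{\mathcal{O}_{X,x}|\mathbb{K}}\;\cong\;\mathcal{O}_{X,x}^{\binom{n+d}{d}}\oplus T_x,$$ where $T_x$ is the torsion submodule of $\mathcal{P}^n_{\mathcal{O}_{X,x}|\mathbb{K}}$. -/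

import Mathlib

open CategoryTheory Limits AlgebraicGeometry

universe u v w
noncomputable section

namespace NashBlowup

section Frames

variable {A B : Type u} [CommRing A] [CommRing B] {r : ℕ}

/-- Let `α : A →+* B`, regard `B` as an `A`-module, and let `S` be a finite set of `r`-tuples of
elements of `B`. These are the relations, in the variables `(f, m, i)` with `f ∈ S`, `m ∈ B` and
`i < r`, saying that `m ↦ (f, m, -)` is `A`-linear, sends the `j`-th entry of `f` to the `j`-th
standard basis vector, and that the maps belonging to `f` and `g` differ by the base change matrix
`(f, g j, i)`. -/
def frameRelations (α : A →+* B) (S : Finset (Fin r → B)) :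
    Set (MvPolynomial (S × B × Fin r) A) :=
  {q | (∃ f m m' i, q = .X (f, m + m', i) - (.X (f, m, i) + .X (f, m', i))) ∨
    (∃ f a m i, q = .X (f, α a * m, i) - .C a * .X (f, m, i)) ∨
    (∃ f j i, q = .X (f, f.1 j, i) - .C (if i = j then 1 else 0)) ∨
    (∃ f g m i, q = .X (f, m, i) - ∑ j, .X (f, g.1 j, i) * .X (g, m, j))}

/-- The coordinate ring of a chart of the Grassmannian of rank `r` locally free quotients of the
`A`-module `B`: its spectrum represents the quotients `B ⊗ C → Q` for which each `r`-tuple in `S`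
is mapped to a basis of `Q`. Such a quotient is recorded by the coordinates `B → C ^ r` with respect
to each of these bases. -/
abbrev FrameRing (α : A →+* B) (S : Finset (Fin r → B)) : Type u :=
  MvPolynomial (S × B × Fin r) A ⧸ Ideal.span (frameRelations α S)

/-- `φ f : B → C ^ r`, for `f ∈ S`, are the coordinate maps, with respect to the images of the
tuples in `S`, of one free rank `r` quotient of `B ⊗ C`, where `C` is an `A`-algebra by `ρ`. -/
structure IsFrameSystem {C : Type v} [CommRing C] (α : A →+* B) (S : Finset (Fin r → B))
    (ρ : A →+* C) (φ : S → B → Fin r → C) : Prop where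
  map_add : ∀ f m m' i, φ f (m + m') i = φ f m i + φ f m' i
  map_smul : ∀ f a m i, φ f (α a * m) i = ρ a * φ f m i
  map_frame : ∀ f j i, φ f (f.1 j) i = if i = j then 1 else 0
  change : ∀ f g m i, φ f m i = ∑ j, φ f (g.1 j) i * φ g m j

namespace FrameRing

variable (α : A →+* B) (S : Finset (Fin r → B))

/-- The structure map of the frame ring as an `A`-algebra. -/
def base : A →+* FrameRing α S := (Ideal.Quotient.mk _).comp MvPolynomial.C

/-- The universal coordinate maps. -/
def coord (f : S) (m : B) (i : Fin r) : FrameRing α S := Ideal.Quotient.mk _ (.X (f, m, i))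

lemma isFrameSystem_coord : IsFrameSystem α S (base α S) (coord α S) where
  map_add f m m' i := by
    rw [coord, coord, coord, ← map_add]
    exact Ideal.Quotient.eq.mpr (Ideal.subset_span (Or.inl ⟨f, m, m', i, rfl⟩))
  map_smul f a m i := by
    rw [coord, coord, base, RingHom.comp_apply, ← map_mul]
    exact Ideal.Quotient.eq.mpr (Ideal.subset_span (Or.inr (Or.inl ⟨f, a, m, i, rfl⟩)))
  map_frame f j i := by
    have : (if i = j then 1 else 0 : FrameRing α S) =
        Ideal.Quotient.mk _ (.C (if i = j then 1 else 0)) := by split_ifs <;> simp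
    rw [this]
    exact Ideal.Quotient.eq.mpr (Ideal.subset_span (Or.inr (Or.inr (Or.inl ⟨f, j, i, rfl⟩))))
  change f g m i := by
    simp only [coord, ← map_mul, ← map_sum]
    exact Ideal.Quotient.eq.mpr (Ideal.subset_span (Or.inr (Or.inr (Or.inr ⟨f, g, m, i, rfl⟩))))

variable {α S} {C : Type v} [CommRing C]

/-- The universal property of the frame ring. -/
def lift (ρ : A →+* C) (φ : S → B → Fin r → C) (h : IsFrameSystem α S ρ φ) :
    FrameRing α S →+* C :=
  Ideal.Quotient.lift _ (MvPolynomial.eval₂Hom ρ fun x ↦ φ x.1 x.2.1 x.2.2) <| by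
    intro q hq
    rw [← RingHom.mem_ker]
    revert q
    change Ideal.span _ ≤ _
    rw [Ideal.span_le]
    rintro q (⟨f, m, m', i, rfl⟩ | ⟨f, a, m, i, rfl⟩ | ⟨f, j, i, rfl⟩ | ⟨f, g, m, i, rfl⟩)
    · simp [RingHom.mem_ker, h.map_add]
    · simp [RingHom.mem_ker, h.map_smul]
    · rw [SetLike.mem_coe, RingHom.mem_ker, map_sub, sub_eq_zero]
      simp only [MvPolynomial.coe_eval₂Hom, MvPolynomial.eval₂_X, MvPolynomial.eval₂_C, h.map_frame]
      split_ifs <;> simp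
    · simp [RingHom.mem_ker, ← h.change]

@[simp] lemma lift_base (ρ : A →+* C) (φ : S → B → Fin r → C) (h : IsFrameSystem α S ρ φ) (a : A) :
    lift ρ φ h (base α S a) = ρ a := by simp [lift, base]

@[simp] lemma lift_coord (ρ : A →+* C) (φ : S → B → Fin r → C) (h : IsFrameSystem α S ρ φ)
    (f : S) (m : B) (i : Fin r) : lift ρ φ h (coord α S f m i) = φ f m i := by simp [lift, coord]

lemma hom_ext {σ τ : FrameRing α S →+* C} (h₁ : ∀ a, σ (base α S a) = τ (base α S a))
    (h₂ : ∀ f m i, σ (coord α S f m i) = τ (coord α S f m i)) : σ = τ := by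
  refine Ideal.Quotient.ringHom_ext (MvPolynomial.ringHom_ext h₁ ?_)
  rintro ⟨f, m, i⟩
  exact h₂ f m i

lemma isFrameSystem_comp (σ : FrameRing α S →+* C) :
    IsFrameSystem α S (σ.comp (base α S)) fun f m i ↦ σ (coord α S f m i) where
  map_add f m m' i := by rw [(isFrameSystem_coord α S).map_add, map_add]
  map_smul f a m i := by rw [(isFrameSystem_coord α S).map_smul, map_mul]; rfl
  map_frame f j i := by rw [(isFrameSystem_coord α S).map_frame]; split_ifs <;> simp
  change f g m i := by
    rw [(isFrameSystem_coord α S).change f g, map_sum]; simp only [map_mul]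

end FrameRing

lemma IsFrameSystem.isUnit_det {C : Type v} [CommRing C] {α : A →+* B} {S : Finset (Fin r → B)}
    {ρ : A →+* C} {φ : S → B → Fin r → C} (h : IsFrameSystem α S ρ φ) (f g : S) :
    IsUnit (Matrix.of fun i j ↦ φ f (g.1 j) i).det := by
  rw [← Matrix.isUnit_iff_isUnit_det]
  refine IsUnit.of_mul_eq_one (Matrix.of fun i j ↦ φ g (f.1 j) i) ?_
  ext i j
  rw [Matrix.mul_apply]
  simp only [Matrix.of_apply]
  rw [← h.change f g, h.map_frame, Matrix.one_apply]

section Restriction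

variable {A' B' : Type u} [CommRing A'] [CommRing B'] {α : A →+* B} {α' : A' →+* B'}
  {S : Finset (Fin r → B)} {S' : Finset (Fin r → B')}

/-- A map from the data `(A → B, S)` to the data `(A' → B', S')`, carrying the tuples in `S` to
tuples in `S'`. -/
structure FrameRestriction (α : A →+* B) (α' : A' →+* B') (S : Finset (Fin r → B))
    (S' : Finset (Fin r → B')) where
  onBase : A →+* A'
  onModule : B →+* B'
  comm : ∀ a, onModule (α a) = α' (onBase a)
  mem : ∀ f ∈ S, (fun j ↦ onModule (f j)) ∈ S'

/-- The image of a tuple. -/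
def FrameRestriction.frame (R : FrameRestriction α α' S S') (f : S) : S' := ⟨_, R.mem f.1 f.2⟩

/-- The induced map of frame rings. -/
def FrameRestriction.hom (R : FrameRestriction α α' S S') : FrameRing α S →+* FrameRing α' S' :=
  FrameRing.lift ((FrameRing.base α' S').comp R.onBase)
    (fun f m i ↦ FrameRing.coord α' S' (R.frame f) (R.onModule m) i)
    { map_add := fun f m m' i ↦ by rw [map_add, (FrameRing.isFrameSystem_coord α' S').map_add]
      map_smul := fun f a m i ↦ by
        rw [map_mul, R.comm, (FrameRing.isFrameSystem_coord α' S').map_smul]; rfl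
      map_frame := fun f j i ↦ (FrameRing.isFrameSystem_coord α' S').map_frame (R.frame f) j i
      change := fun f g m i ↦
        (FrameRing.isFrameSystem_coord α' S').change (R.frame f) (R.frame g) _ i }

@[simp] lemma FrameRestriction.hom_base (R : FrameRestriction α α' S S') (a : A) :
    R.hom (FrameRing.base α S a) = FrameRing.base α' S' (R.onBase a) := by simp [hom]

@[simp] lemma FrameRestriction.hom_coord (R : FrameRestriction α α' S S') (f : S) (m : B) (i : Fin r) :
    R.hom (FrameRing.coord α S f m i) =
      FrameRing.coord α' S' (R.frame f) (R.onModule m) i := by simp [hom]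

/-- The map of data is the localization at the element `a` of `A`. -/
structure FrameRestriction.IsAway (R : FrameRestriction α α' S S') (a : A) : Prop where
  onBase : letI := R.onBase.toAlgebra; IsLocalization.Away a A'
  onModule : letI := R.onModule.toAlgebra; IsLocalization.Away (α a) B'

namespace FrameRestriction.IsAway

variable {R : FrameRestriction α α' S S'} {a : A} {C : Type v} [CommRing C]

lemma isUnit_onBase (hR : R.IsAway a) : IsUnit (R.onBase a) := by
  let := R.onBase.toAlgebra
  have := hR.onBase
  exact IsLocalization.Away.algebraMap_isUnit a

lemma exists_base (hR : R.IsAway a) (x : A') : ∃ k y, R.onBase a ^ k * x = R.onBase y := by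
  let := R.onBase.toAlgebra
  have := hR.onBase
  obtain ⟨k, y, h⟩ := IsLocalization.Away.surj a x
  exact ⟨k, y, by rw [mul_comm]; exact h⟩

lemma exists_module (hR : R.IsAway a) (x : B') : ∃ k y, R.onModule (α a) ^ k * x = R.onModule y := by
  let := R.onModule.toAlgebra
  have := hR.onModule
  obtain ⟨k, y, h⟩ := IsLocalization.Away.surj (α a) x
  exact ⟨k, y, by rw [mul_comm]; exact h⟩

lemma exists_of_eq (hR : R.IsAway a) {x y : B} (h : R.onModule x = R.onModule y) :
    ∃ k, α a ^ k * x = α a ^ k * y := by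
  let := R.onModule.toAlgebra
  have := hR.onModule
  exact IsLocalization.Away.exists_of_eq (α a) h

lemma exists_lift (hR : R.IsAway a) (ρ : A →+* C) (ha : IsUnit (ρ a)) :
    ∃ ρ' : A' →+* C, ρ'.comp R.onBase = ρ := by
  let := R.onBase.toAlgebra
  have := hR.onBase
  exact ⟨IsLocalization.Away.lift a ha, IsLocalization.Away.lift_comp a ha⟩

lemma base_ext (hR : R.IsAway a) {ρ ρ' : A' →+* C} (h : ρ.comp R.onBase = ρ'.comp R.onBase) : ρ = ρ' := by
  let := R.onBase.toAlgebra
  have := hR.onBase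
  exact IsLocalization.ringHom_ext (Submonoid.powers a) h

end FrameRestriction.IsAway

/-- `φ : B → C ^ r` is `A`-linear, where `C` is an `A`-algebra by `ρ`. -/
structure IsSemilinear {C : Type v} [CommRing C] (α : A →+* B) (ρ : A →+* C) (φ : B → Fin r → C) :
    Prop where
  map_add : ∀ m m' i, φ (m + m') i = φ m i + φ m' i
  map_smul : ∀ a m i, φ (α a * m) i = ρ a * φ m i

lemma IsSemilinear.map_pow_mul {C : Type v} [CommRing C] {ρ : A →+* C} {φ : B → Fin r → C}
    (h : IsSemilinear α ρ φ) (a : A) (k : ℕ) (m : B) (i : Fin r) :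
    φ (α a ^ k * m) i = ρ a ^ k * φ m i := by
  rw [← map_pow α, h.map_smul, map_pow]

namespace FrameRestriction.IsAway

variable {R : FrameRestriction α α' S S'} {a : A} {C : Type v} [CommRing C]

lemma semilinear_ext (hR : R.IsAway a) {ρ' : A' →+* C} {φ ψ : B' → Fin r → C} (hφ : IsSemilinear α' ρ' φ)
    (hψ : IsSemilinear α' ρ' ψ) (h : ∀ m, φ (R.onModule m) = ψ (R.onModule m)) : φ = ψ := by
  funext x i
  obtain ⟨k, y, hy⟩ := hR.exists_module x
  have hu : IsUnit (ρ' (R.onBase a) ^ k) := (hR.isUnit_onBase.map ρ').pow k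
  refine hu.mul_left_cancel ?_
  rw [← hφ.map_pow_mul, ← hψ.map_pow_mul, ← R.comm, hy, h]

lemma exists_semilinear (hR : R.IsAway a) {ρ : A →+* C} {φ : B → Fin r → C} (hφ : IsSemilinear α ρ φ)
    (ρ' : A' →+* C) (hρ : ρ'.comp R.onBase = ρ) :
    ∃ φ' : B' → Fin r → C, IsSemilinear α' ρ' φ' ∧ ∀ m, φ' (R.onModule m) = φ m := by
  have hu : IsUnit (ρ a) := by rw [← hρ]; exact hR.isUnit_onBase.map ρ'
  choose k y hy using hR.exists_module
  obtain ⟨u, hu⟩ := hu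
  let φ' : B' → Fin r → C := fun x i ↦ ((u⁻¹ ^ k x : Cˣ) : C) * φ (y x) i
  have key : ∀ x K n i, R.onModule (α a) ^ K * x = R.onModule n → ρ a ^ K * φ' x i = φ n i := by
    intro x K n i h
    have h1 : R.onModule (α a ^ K * y x) = R.onModule (α a ^ k x * n) := by
      rw [map_mul, map_mul, map_pow, map_pow, ← hy, ← h]; ring
    obtain ⟨N, hN⟩ := hR.exists_of_eq h1
    have h2 := congrArg (fun z ↦ φ z i) hN
    simp only [hφ.map_pow_mul] at h2
    rw [← hu] at h2 ⊢
    have h3 : (u : C) ^ k x * ((u⁻¹ ^ k x : Cˣ) : C) = 1 := by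
      rw [← Units.val_pow_eq_pow_val, ← Units.val_mul, inv_pow, mul_inv_cancel, Units.val_one]
    have hu' : IsUnit ((u : C) ^ N * (u : C) ^ k x) := by
      rw [← pow_add]; exact (u.isUnit).pow _
    refine hu'.mul_left_cancel ?_
    calc _ = (u : C) ^ N * ((u : C) ^ K * φ (y x) i) * ((u : C) ^ k x * ((u⁻¹ ^ k x : Cˣ) : C)) := by
          simp only [φ']; ring
      _ = _ := by rw [h2, h3]; ring
  have hua : IsUnit (ρ a) := ⟨u, hu⟩
  refine ⟨φ', ⟨fun m m' i ↦ ?_, fun b m i ↦ ?_⟩, fun m ↦ ?_⟩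
  · refine (hua.pow (k m + k m')).mul_left_cancel ?_
    rw [mul_add, key (m + m') (k m + k m') (α a ^ k m' * y m + α a ^ k m * y m') i,
      hφ.map_add, hφ.map_pow_mul, hφ.map_pow_mul, ← key m _ _ i (hy m), ← key m' _ _ i (hy m')]
    · ring
    · simp only [map_add, map_mul, map_pow, ← hy]; ring
  · obtain ⟨K, c, hc⟩ := hR.exists_base b
    refine (hua.pow (K + k m)).mul_left_cancel ?_
    rw [key (α' b * m) (K + k m) (α c * y m) i, hφ.map_smul, ← key m _ _ i (hy m)]
    · have : ρ c = ρ a ^ K * ρ' b := by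
        rw [← hρ, RingHom.comp_apply, ← hc, map_mul, map_pow]; rfl
      rw [this]; ring
    · rw [map_mul R.onModule, R.comm c, ← hc, ← hy, map_mul, map_pow, R.comm]; ring
  · funext i
    simpa using key (R.onModule m) 0 m i (by simp)

lemma hom_ext (hR : R.IsAway a) (hS : S.Nonempty) {σ τ : FrameRing α' S' →+* C} (h : σ.comp R.hom = τ.comp R.hom) :
    σ = τ := by
  obtain ⟨f, hf⟩ := hS
  have hb : σ.comp (FrameRing.base α' S') = τ.comp (FrameRing.base α' S') := by
    refine hR.base_ext (RingHom.ext fun x ↦ ?_)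
    simpa using congrArg (fun s ↦ s (FrameRing.base α S x)) h
  have hσ := FrameRing.isFrameSystem_comp σ
  have hτ := FrameRing.isFrameSystem_comp τ
  have hc : (fun m i ↦ σ (FrameRing.coord α' S' (R.frame ⟨f, hf⟩) m i)) =
      fun m i ↦ τ (FrameRing.coord α' S' (R.frame ⟨f, hf⟩) m i) := by
    refine hR.semilinear_ext (ρ' := σ.comp (FrameRing.base α' S'))
      ⟨hσ.map_add _, hσ.map_smul _⟩ ⟨hτ.map_add _, by rw [hb]; exact hτ.map_smul _⟩ fun m ↦ ?_
    funext i
    simpa using congrArg (fun s ↦ s (FrameRing.coord α S ⟨f, hf⟩ m i)) h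
  refine FrameRing.hom_ext (fun x ↦ congrArg (fun s ↦ s x) hb) fun g m i ↦ ?_
  have e : ∀ m i, σ (FrameRing.coord α' S' (R.frame ⟨f, hf⟩) m i) =
    τ (FrameRing.coord α' S' (R.frame ⟨f, hf⟩) m i) := fun m i ↦ congrFun (congrFun hc m) i
  have hu := (Matrix.isUnit_iff_isUnit_det _).mpr (hσ.isUnit_det (R.frame ⟨f, hf⟩) g)
  have hinj := Matrix.mulVec_injective_of_isUnit hu
  refine congrFun (hinj (a₁ := fun i ↦ σ (FrameRing.coord α' S' g m i))
    (a₂ := fun i ↦ τ (FrameRing.coord α' S' g m i)) ?_) i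
  funext l
  simp only [Matrix.mulVec, dotProduct, Matrix.of_apply]
  rw [← hσ.change, e]
  simp only [e]
  exact hτ.change _ g m l

end FrameRestriction.IsAway

lemma FrameRestriction.exists_extension (R : FrameRestriction α α' S S') {C : Type v} [CommRing C]
    (σ : FrameRing α S →+* C) (ρ' : A' →+* C)
    (hρ : ρ'.comp R.onBase = σ.comp (FrameRing.base α S)) (f : S) (φ : B' → Fin r → C)
    (hφ : IsSemilinear α' ρ' φ)
    (hφσ : ∀ m i, φ (R.onModule m) i = σ (FrameRing.coord α S f m i))
    (hdet : ∀ g ∈ S', IsUnit (Matrix.of fun i j ↦ φ (g j) i).det) :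
    ∃ σ' : FrameRing α' S' →+* C, σ'.comp R.hom = σ := by
  let P : S' → Matrix (Fin r) (Fin r) C := fun g ↦ Matrix.of fun i j ↦ φ (g.1 j) i
  have hP : ∀ g, (P g)⁻¹ * P g = 1 := fun g ↦ Matrix.nonsing_inv_mul _ (hdet g.1 g.2)
  have hP' : ∀ g, P g * (P g)⁻¹ = 1 := fun g ↦ Matrix.mul_nonsing_inv _ (hdet g.1 g.2)
  let ψ : S' → B' → Fin r → C := fun g m ↦ (P g)⁻¹.mulVec (φ m)
  have hψ : IsFrameSystem α' S' ρ' ψ :=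
    { map_add := fun g m m' i ↦ by
        have : φ (m + m') = φ m + φ m' := funext (hφ.map_add m m')
        simp only [ψ, this, Matrix.mulVec_add, Pi.add_apply]
      map_smul := fun g c m i ↦ by
        have : φ (α' c * m) = ρ' c • φ m := funext (hφ.map_smul c m)
        simp only [ψ, this, Matrix.mulVec_smul, Pi.smul_apply, smul_eq_mul]
      map_frame := fun g j i ↦ by
        have := congrFun (congrFun (hP g) i) j
        rw [Matrix.mul_apply, Matrix.one_apply] at this
        exact this
      change := fun f g m i ↦ by
        have h1 : ψ f m = (P f)⁻¹.mulVec ((P g).mulVec (ψ g m)) := by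
          simp only [ψ, Matrix.mulVec_mulVec]
          rw [hP', mul_one]
        rw [h1, Matrix.mulVec_mulVec]
        simp only [Matrix.mulVec, dotProduct, Matrix.mul_apply, ψ]
        rfl }
  refine ⟨FrameRing.lift ρ' ψ hψ, FrameRing.hom_ext (fun c ↦ ?_) fun g m i ↦ ?_⟩
  · simpa using congrArg (fun s ↦ s c) hρ
  · simp only [RingHom.comp_apply, hom_coord, FrameRing.lift_coord]
    have hσ := FrameRing.isFrameSystem_comp σ
    have h1 : φ (R.onModule m) = (P (R.frame g)).mulVec fun i ↦ σ (FrameRing.coord α S g m i) := by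
      funext l
      rw [hφσ]
      simp only [Matrix.mulVec, dotProduct, P, Matrix.of_apply]
      rw [hσ.change f g]
      simp only [FrameRestriction.frame, hφσ]
    simp only [ψ, h1, Matrix.mulVec_mulVec, hP, Matrix.one_mulVec]

namespace FrameRestriction.IsAway

variable {R : FrameRestriction α α' S S'} {a : A}

lemma isOpenImmersion (hR : R.IsAway a) (hS : S.Nonempty) :
    AlgebraicGeometry.IsOpenImmersion (AlgebraicGeometry.Spec.map (CommRingCat.ofHom R.hom)) := by
  obtain ⟨f, hf⟩ := hS
  let L := Localization.Away (FrameRing.base α S a)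
  let ι : FrameRing α S →+* L := algebraMap _ _
  have hι := FrameRing.isFrameSystem_comp ι
  have hu : IsUnit ((ι.comp (FrameRing.base α S)) a) :=
    IsLocalization.Away.algebraMap_isUnit (FrameRing.base α S a)
  obtain ⟨ρ', hρ'⟩ := hR.exists_lift (ι.comp (FrameRing.base α S)) hu
  obtain ⟨φ, hφ, hφι⟩ := hR.exists_semilinear (ρ := ι.comp (FrameRing.base α S))
    (φ := fun m i ↦ ι (FrameRing.coord α S ⟨f, hf⟩ m i))
    ⟨hι.map_add _, hι.map_smul _⟩ ρ' hρ'
  let D : L := ∏ g ∈ S', (Matrix.of fun i j ↦ φ (g j) i).det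
  let L₂ := Localization.Away D
  let κ : L →+* L₂ := algebraMap _ _
  have hD : IsUnit (κ D) := IsLocalization.Away.algebraMap_isUnit _
  have hmap : ∀ {C : Type u} [CommRing C] (s : L →+* C) (g : Fin r → B'),
      s (Matrix.of fun i j ↦ φ (g j) i).det = (Matrix.of fun i j ↦ s (φ (g j) i)).det := by
    intro C _ s g
    rw [RingHom.map_det]
    rfl
  obtain ⟨σ', hσ'⟩ := R.exists_extension (κ.comp ι) (κ.comp ρ')
    (by rw [RingHom.comp_assoc, hρ', RingHom.comp_assoc]) ⟨f, hf⟩ (fun m i ↦ κ (φ m i))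
    ⟨fun m m' i ↦ by rw [hφ.map_add, map_add], fun c m i ↦ by rw [hφ.map_smul, map_mul]; rfl⟩
    (fun m i ↦ by rw [hφι]; rfl) (fun g hg ↦ by
      rw [← hmap]
      exact isUnit_of_dvd_unit (map_dvd κ (Finset.dvd_prod_of_mem
        (fun g : Fin r → B' ↦ (Matrix.of fun i j ↦ φ (g j) i).det) hg)) hD)
  have hua : IsUnit (R.hom (FrameRing.base α S a)) := by
    rw [R.hom_base]
    exact hR.isUnit_onBase.map _
  let l₁ : L →+* FrameRing α' S' := IsLocalization.Away.lift (FrameRing.base α S a) hua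
  have hl₁ : l₁.comp ι = R.hom := IsLocalization.Away.lift_comp _ hua
  have hb : l₁.comp ρ' = FrameRing.base α' S' := by
    refine hR.base_ext ?_
    rw [RingHom.comp_assoc, hρ', ← RingHom.comp_assoc, hl₁]
    ext x
    simp
  have huniv := FrameRing.isFrameSystem_coord α' S'
  have hlφ : (fun m i ↦ l₁ (φ m i)) = FrameRing.coord α' S' (R.frame ⟨f, hf⟩) := by
    refine hR.semilinear_ext (ρ' := FrameRing.base α' S')
      ⟨fun m m' i ↦ by rw [hφ.map_add, map_add],
        fun c m i ↦ by rw [hφ.map_smul, map_mul, ← hb]; rfl⟩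
      ⟨huniv.map_add _, huniv.map_smul _⟩ fun m ↦ ?_
    funext i
    rw [hφι, ← R.hom_coord, ← hl₁]
    rfl
  have hDu : IsUnit (l₁ D) := by
    rw [map_prod, IsUnit.prod_iff]
    intro g hg
    rw [hmap]
    have := huniv.isUnit_det (R.frame ⟨f, hf⟩) ⟨g, hg⟩
    rwa [← hlφ] at this
  let l₂ : L₂ →+* FrameRing α' S' := IsLocalization.Away.lift D hDu
  have hl₂ : l₂.comp κ = l₁ := IsLocalization.Away.lift_comp _ hDu
  have h1 : l₂.comp σ' = RingHom.id _ := by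
    refine hR.hom_ext ⟨f, hf⟩ ?_
    rw [RingHom.comp_assoc, hσ', ← RingHom.comp_assoc, hl₂, hl₁, RingHom.id_comp]
  have h2 : σ'.comp l₂ = RingHom.id _ := by
    refine IsLocalization.ringHom_ext (Submonoid.powers D) ?_
    refine IsLocalization.ringHom_ext (Submonoid.powers (FrameRing.base α S a)) ?_
    change (σ'.comp (l₂.comp κ)).comp ι = κ.comp ι
    rw [hl₂, RingHom.comp_assoc, hl₁, hσ']
  have hR' : R.hom = (l₂.comp κ).comp ι := by rw [hl₂, hl₁]
  let e : L₂ ≃+* FrameRing α' S' := RingEquiv.ofRingHom l₂ σ' h1 h2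
  have : IsIso (CommRingCat.ofHom l₂) := e.toCommRingCatIso.isIso_hom
  have hι' : AlgebraicGeometry.IsOpenImmersion (AlgebraicGeometry.Spec.map (CommRingCat.ofHom ι)) :=
    AlgebraicGeometry.IsOpenImmersion.of_isLocalization (FrameRing.base α S a)
  have hκ' : AlgebraicGeometry.IsOpenImmersion (AlgebraicGeometry.Spec.map (CommRingCat.ofHom κ)) :=
    AlgebraicGeometry.IsOpenImmersion.of_isLocalization D
  have hRe : CommRingCat.ofHom R.hom =
      (CommRingCat.ofHom ι ≫ CommRingCat.ofHom κ) ≫ CommRingCat.ofHom l₂ := by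
    rw [← CommRingCat.ofHom_comp, ← CommRingCat.ofHom_comp, ← RingHom.comp_assoc, hR']
  rw [hRe, AlgebraicGeometry.Spec.map_comp, AlgebraicGeometry.Spec.map_comp]
  infer_instance

end FrameRestriction.IsAway

lemma FrameRestriction.exists_common {A₁ B₁ A₂ B₂ A₁₂ B₁₂ : Type u} [CommRing A₁] [CommRing B₁]
    [CommRing A₂] [CommRing B₂] [CommRing A₁₂] [CommRing B₁₂] {α₁ : A₁ →+* B₁} {α₂ : A₂ →+* B₂}
    {α₁₂ : A₁₂ →+* B₁₂} {S₁ : Finset (Fin r → B₁)} {S₂ : Finset (Fin r → B₂)}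
    {S₁₂ : Finset (Fin r → B₁₂)} (hS : S.Nonempty)
    (R₁ : FrameRestriction α α₁ S S₁) (R₂ : FrameRestriction α α₂ S S₂)
    (T₁ : FrameRestriction α₁ α₁₂ S₁ S₁₂) (T₂ : FrameRestriction α₂ α₁₂ S₂ S₁₂)
    (hB : T₁.onBase.comp R₁.onBase = T₂.onBase.comp R₂.onBase)
    (hM : T₁.onModule.comp R₁.onModule = T₂.onModule.comp R₂.onModule)
    {a₂ : A} (h₂ : R₂.IsAway a₂) (k₁ : T₁.IsAway (R₁.onBase a₂))
    (hS₁₂ : ∀ g ∈ S₁₂, (∃ f ∈ S₁, (fun j ↦ T₁.onModule (f j)) = g) ∨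
      ∃ f ∈ S₂, (fun j ↦ T₂.onModule (f j)) = g)
    {C : Type v} [CommRing C] (σ₁ : FrameRing α₁ S₁ →+* C) (σ₂ : FrameRing α₂ S₂ →+* C)
    (h : σ₁.comp R₁.hom = σ₂.comp R₂.hom) :
    ∃ σ : FrameRing α₁₂ S₁₂ →+* C, σ.comp T₁.hom = σ₁ ∧ σ.comp T₂.hom = σ₂ := by
  obtain ⟨f, hf⟩ := hS
  have e₁ := FrameRing.isFrameSystem_comp σ₁
  have e₂ := FrameRing.isFrameSystem_comp σ₂
  have hbase : (σ₁.comp (FrameRing.base α₁ S₁)).comp R₁.onBase =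
      (σ₂.comp (FrameRing.base α₂ S₂)).comp R₂.onBase := by
    ext x
    simpa using congrArg (fun s ↦ s (FrameRing.base α S x)) h
  have hu : IsUnit ((σ₁.comp (FrameRing.base α₁ S₁)) (R₁.onBase a₂)) := by
    have := congrArg (fun s ↦ s a₂) hbase
    simp only [RingHom.comp_apply] at this ⊢
    rw [this]
    exact (h₂.isUnit_onBase.map (FrameRing.base α₂ S₂)).map σ₂
  obtain ⟨ρ, hρ⟩ := k₁.exists_lift _ hu
  have hρ₂ : ρ.comp T₂.onBase = σ₂.comp (FrameRing.base α₂ S₂) := by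
    refine h₂.base_ext ?_
    rw [RingHom.comp_assoc, ← hB, ← RingHom.comp_assoc, hρ, hbase]
  obtain ⟨φ, hφ, hφ₁⟩ := k₁.exists_semilinear (ρ := σ₁.comp (FrameRing.base α₁ S₁))
    (φ := fun m i ↦ σ₁ (FrameRing.coord α₁ S₁ (R₁.frame ⟨f, hf⟩) m i))
    ⟨e₁.map_add _, e₁.map_smul _⟩ ρ hρ
  have hφ₂ : (fun m ↦ φ (T₂.onModule m)) =
      fun m i ↦ σ₂ (FrameRing.coord α₂ S₂ (R₂.frame ⟨f, hf⟩) m i) := by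
    refine h₂.semilinear_ext (ρ' := ρ.comp T₂.onBase)
      ⟨fun m m' i ↦ by rw [map_add, hφ.map_add],
        fun c m i ↦ by rw [map_mul, T₂.comm, hφ.map_smul]; rfl⟩
      ⟨e₂.map_add _, by rw [hρ₂]; exact e₂.map_smul _⟩ fun m ↦ ?_
    have := congrArg (fun s ↦ s m) hM
    simp only [RingHom.comp_apply] at this
    funext i
    rw [← this, hφ₁]
    simpa using congrArg (fun s ↦ s (FrameRing.coord α S ⟨f, hf⟩ m i)) h
  obtain ⟨σ, hσ⟩ := T₁.exists_extension σ₁ ρ hρ (R₁.frame ⟨f, hf⟩) φ hφ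
    (fun m i ↦ by rw [hφ₁]) (fun g hg ↦ by
      obtain ⟨g, hg', rfl⟩ | ⟨g, hg', rfl⟩ := hS₁₂ g hg
      · simp only [hφ₁]
        exact e₁.isUnit_det _ ⟨g, hg'⟩
      · have : ∀ m, φ (T₂.onModule m) =
            fun i ↦ σ₂ (FrameRing.coord α₂ S₂ (R₂.frame ⟨f, hf⟩) m i) := fun m ↦ congrFun hφ₂ m
        simp only [this]
        exact e₂.isUnit_det _ ⟨g, hg'⟩)
  refine ⟨σ, hσ, h₂.hom_ext ⟨f, hf⟩ ?_⟩
  rw [← h, ← hσ, RingHom.comp_assoc, RingHom.comp_assoc]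
  congr 1
  refine FrameRing.hom_ext (fun x ↦ ?_) fun g m i ↦ ?_
  · simpa using congrArg (fun s ↦ FrameRing.base α₁₂ S₁₂ (s x)) hB.symm
  · have hm : ∀ m, T₂.onModule (R₂.onModule m) = T₁.onModule (R₁.onModule m) :=
      fun m ↦ congrArg (fun s ↦ s m) hM.symm
    simp only [RingHom.comp_apply, FrameRestriction.hom_coord, hm]
    congr 1
    ext j
    exact hm _

end Restriction

section Basis

variable (α : A →+* B)

/-- The coordinates with respect to an `A`-basis `b` of `B`. -/
lemma isFrameSystem_basis (b : letI := α.toAlgebra; Module.Basis (Fin r) A B) :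
    letI := α.toAlgebra
    IsFrameSystem α {⇑b} (RingHom.id A) fun _ m i ↦ b.repr m i := by
  let := α.toAlgebra
  have hs : ∀ (a : A) (m : B), α a * m = a • m := fun a m ↦ (Algebra.smul_def a m).symm
  refine ⟨fun f m m' i ↦ by simp, fun f a m i ↦ by simp [hs], ?_, ?_⟩
  · rintro ⟨f, hf⟩ j i
    obtain rfl := Finset.mem_singleton.mp hf
    rw [b.repr_self_apply]
    simp only [eq_comm]
  · rintro f ⟨g, hg⟩ m i
    obtain rfl := Finset.mem_singleton.mp hg
    simp [Finsupp.single_apply]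

/-- The `A`-valued point of the chart of an `A`-basis `b` of `B` that is given by the identity
quotient `B → B`. -/
def basisPoint (b : letI := α.toAlgebra; Module.Basis (Fin r) A B) :
    FrameRing α {⇑b} →+* A :=
  FrameRing.lift (RingHom.id A) _ (isFrameSystem_basis α b)

lemma basisPoint_comp_base (b : letI := α.toAlgebra; Module.Basis (Fin r) A B) :
    (basisPoint α b).comp (FrameRing.base α {⇑b}) = RingHom.id A := by
  ext a
  simp [basisPoint]

end Basis

end Frames

section Grassmannian

open Scheme

lemma exists_prime_of_forall_field {R₀ R₁ R₂ R₁₂ : Type u} [CommRing R₀] [CommRing R₁] [CommRing R₂]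
    [CommRing R₁₂] (r₁ : R₀ →+* R₁) (r₂ : R₀ →+* R₂) (t₁ : R₁ →+* R₁₂) (t₂ : R₂ →+* R₁₂)
    (H : ∀ (C : Type u) [Field C] (σ₁ : R₁ →+* C) (σ₂ : R₂ →+* C), σ₁.comp r₁ = σ₂.comp r₂ →
      ∃ σ : R₁₂ →+* C, σ.comp t₁ = σ₁ ∧ σ.comp t₂ = σ₂)
    (x₁ : Spec (.of R₁)) (x₂ : Spec (.of R₂))
    (hx : Spec.map (CommRingCat.ofHom r₁) x₁ = Spec.map (CommRingCat.ofHom r₂) x₂) :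
    ∃ z : Spec (.of R₁₂), Spec.map (CommRingCat.ofHom t₁) z = x₁ ∧
      Spec.map (CommRingCat.ofHom t₂) z = x₂ := by
  obtain ⟨y, hy₁, hy₂⟩ := Scheme.Pullback.exists_preimage_pullback x₁ x₂ hx
  let P := pullback (Spec.map (CommRingCat.ofHom r₁)) (Spec.map (CommRingCat.ofHom r₂))
  let q : Spec (P.residueField y) ⟶ P := P.fromSpecResidueField y
  let s₁ := Spec.preimage (q ≫ pullback.fst _ _)
  let s₂ := Spec.preimage (q ≫ pullback.snd _ _)
  have hs : CommRingCat.ofHom r₁ ≫ s₁ = CommRingCat.ofHom r₂ ≫ s₂ := by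
    apply Spec.map_injective
    rw [Spec.map_comp, Spec.map_comp, Spec.map_preimage, Spec.map_preimage, Category.assoc,
      Category.assoc, pullback.condition]
  obtain ⟨σ, hσ₁, hσ₂⟩ := H (P.residueField y) s₁.hom s₂.hom (congrArg CommRingCat.Hom.hom hs)
  let z : Spec (P.residueField y) ⟶ Spec (.of R₁₂) := Spec.map (CommRingCat.ofHom σ)
  have hz₁ : z ≫ Spec.map (CommRingCat.ofHom t₁) = q ≫ pullback.fst _ _ := by
    change Spec.map (CommRingCat.ofHom σ) ≫ _ = _
    rw [← Spec.map_comp, ← CommRingCat.ofHom_comp, hσ₁]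
    exact Spec.map_preimage _
  have hz₂ : z ≫ Spec.map (CommRingCat.ofHom t₂) = q ≫ pullback.snd _ _ := by
    change Spec.map (CommRingCat.ofHom σ) ≫ _ = _
    rw [← Spec.map_comp, ← CommRingCat.ofHom_comp, hσ₂]
    exact Spec.map_preimage _
  let o : Spec (P.residueField y) := IsLocalRing.closedPoint (P.residueField y)
  have hq : q o = y := P.fromSpecResidueField_apply y o
  refine ⟨z o, ?_, ?_⟩
  · rw [← Scheme.Hom.comp_apply, hz₁, Scheme.Hom.comp_apply, hq, hy₁]
  · rw [← Scheme.Hom.comp_apply, hz₂, Scheme.Hom.comp_apply, hq, hy₂]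

variable {X Z : Scheme.{u}} (p : Z ⟶ X) (r : ℕ)

/-- The charts of the Grassmannian of `p_* 𝒪_Z`: an affine open `V` of `X` together with a
nonempty finite set of `r`-tuples of sections of `p_* 𝒪_Z` over `V`. -/
@[ext]
structure GrassmannianIndex where
  V : X.AffineZariskiSite
  S : Finset (Fin r → Γ(Z, p ⁻¹ᵁ V.toOpens))
  nonempty : S.Nonempty

variable {p} in
/-- The restriction maps of `p_* 𝒪_Z`. -/
def sectionRestrict {V W : X.AffineZariskiSite} (h : V ≤ W) : Γ(Z, p ⁻¹ᵁ W.toOpens) →+* Γ(Z, p ⁻¹ᵁ V.toOpens) :=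
  (Z.presheaf.map (homOfLE (p.preimage_mono (AffineZariskiSite.toOpens_mono h))).op).hom

variable {p} in
lemma sectionRestrict_refl (V : X.AffineZariskiSite) :
    sectionRestrict (p := p) (le_refl V) = RingHom.id _ := by
  ext x
  simp [sectionRestrict]

variable {p} in
lemma sectionRestrict_trans {U V W : X.AffineZariskiSite} (h : U ≤ V) (h' : V ≤ W) :
    (sectionRestrict (p := p) h).comp (sectionRestrict h') = sectionRestrict (h.trans h') := by
  rw [sectionRestrict, sectionRestrict, ← CommRingCat.hom_comp, ← Functor.map_comp]
  rfl

/-- `i ≤ j` if the affine open of `i` is a basic open of that of `j`, and `i` contains the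
restrictions of all tuples in `j`; then the chart of `i` is an open subscheme of that of `j`. -/
instance : Preorder (GrassmannianIndex p r) where
  le i j := ∃ h : i.V ≤ j.V, ∀ f ∈ j.S, (fun t ↦ sectionRestrict h (f t)) ∈ i.S
  le_refl i := ⟨le_rfl, fun f hf ↦ by simpa [sectionRestrict_refl] using hf⟩
  le_trans i j k := fun ⟨h, H⟩ ⟨h', H'⟩ ↦ ⟨h.trans h', fun f hf ↦ by
    rw [← sectionRestrict_trans h h']
    exact H _ (H' f hf)⟩

variable {p r}

namespace GrassmannianIndex

/-- The coordinate ring of a chart. -/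
abbrev ring (i : GrassmannianIndex p r) : Type u := FrameRing (p.app i.V.toOpens).hom i.S

/-- Restriction from the chart `j` to a smaller chart `i`. -/
def restriction {i j : GrassmannianIndex p r} (h : i ≤ j) :
    FrameRestriction (p.app j.V.toOpens).hom (p.app i.V.toOpens).hom j.S i.S where
  onBase := (X.presheaf.map (homOfLE (AffineZariskiSite.toOpens_mono h.choose)).op).hom
  onModule := sectionRestrict h.choose
  comm a := by
    rw [sectionRestrict, ← RingHom.comp_apply, ← RingHom.comp_apply, ← CommRingCat.hom_comp,
      ← CommRingCat.hom_comp]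
    exact congrArg (fun s ↦ CommRingCat.Hom.hom s a)
      (p.naturality (homOfLE (AffineZariskiSite.toOpens_mono h.choose)).op).symm
  mem f hf := h.choose_spec f hf

variable (p r) in
/-- The charts of the Grassmannian and their inclusions. -/
def chartFunctor : GrassmannianIndex p r ⥤ Scheme.{u} where
  obj i := Spec (.of i.ring)
  map h := Spec.map (CommRingCat.ofHom (restriction h.le).hom)
  map_id i := by
    rw [← Spec.map_id]
    congr 1
    ext1
    refine FrameRing.hom_ext (fun a ↦ ?_) fun f m t ↦ ?_
    · simp [restriction]
    · have : ∀ h : i ≤ i, (restriction h).onModule = RingHom.id _ := fun h ↦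
        sectionRestrict_refl i.V
      simp [this, FrameRestriction.frame]
  map_comp {i j k} h h' := by
    rw [← Spec.map_comp, ← CommRingCat.ofHom_comp]
    congr 2
    have e : (restriction h.le).onModule.comp (restriction h'.le).onModule =
      (restriction (h ≫ h').le).onModule := sectionRestrict_trans h.le.choose h'.le.choose
    have e' : ∀ m, (restriction h.le).onModule ((restriction h'.le).onModule m) =
      (restriction (h ≫ h').le).onModule m := fun m ↦ congrArg (fun s ↦ s m) e
    refine FrameRing.hom_ext (fun a ↦ ?_) fun f m t ↦ ?_
    · simp only [RingHom.comp_apply, FrameRestriction.hom_base]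
      congr 1
      simp only [restriction]
      rw [← RingHom.comp_apply, ← CommRingCat.hom_comp, ← Functor.map_comp]
      rfl
    · simp only [RingHom.comp_apply, FrameRestriction.hom_coord, FrameRestriction.frame, e']

lemma isLocalization_sections {W W' : Z.Opens} (f : Γ(Z, W)) (hc : IsCompact (W : Set Z))
    (hq : IsQuasiSeparated (W : Set Z)) (h : W' ≤ W) (e : Z.basicOpen f = W') :
    letI := (Z.presheaf.map (homOfLE h).op).hom.toAlgebra
    IsLocalization.Away f Γ(Z, W') := by
  subst e
  exact isLocalization_basicOpen_of_qcqs hc hq f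

lemma restriction_isAway [QuasiCompact p] [QuasiSeparated p] {i j : GrassmannianIndex p r}
    (h : i ≤ j) (a : Γ(X, j.V.toOpens)) (ha : X.basicOpen a = i.V.toOpens) : (restriction h).IsAway a := by
  obtain ⟨V, S, hS⟩ := i
  obtain rfl : j.V.basicOpen a = V := Subtype.ext ha
  constructor
  · exact j.V.2.isLocalization_basicOpen a
  · exact isLocalization_sections (p.app j.V.toOpens a) (p.isCompact_preimage j.V.2.isCompact)
      (p.isQuasiSeparated_preimage j.V.2.isQuasiSeparated) _ (p.preimage_basicOpen a).symm

instance [QuasiCompact p] [QuasiSeparated p] {i j : GrassmannianIndex p r} (h : i ⟶ j) :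
    IsOpenImmersion ((chartFunctor p r).map h) := by
  obtain ⟨a, ha⟩ := h.le.choose
  exact (restriction_isAway h.le a ha).isOpenImmersion j.nonempty

instance [QuasiCompact p] [QuasiSeparated p] :
    (chartFunctor p r ⋙ Scheme.forget).IsLocallyDirected where
  cond {i j k} hi hj xi xj hx := by
    classical
    obtain ⟨a₁, ha₁⟩ := hi.le.choose
    obtain ⟨a₂, ha₂⟩ := hj.le.choose
    let V : X.AffineZariskiSite := k.V.basicOpen (a₁ * a₂)
    have hV₁ : X.basicOpen ((restriction hi.le).onBase a₂) = V.toOpens := by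
      change X.basicOpen (X.presheaf.map _ a₂) = X.basicOpen (a₁ * a₂)
      rw [X.basicOpen_res, X.basicOpen_mul, ha₁]
    have hV₂ : X.basicOpen ((restriction hj.le).onBase a₁) = V.toOpens := by
      change X.basicOpen (X.presheaf.map _ a₁) = X.basicOpen (a₁ * a₂)
      rw [X.basicOpen_res, X.basicOpen_mul, ha₂, inf_comm]
    have hVi : V ≤ i.V := ⟨_, hV₁⟩
    have hVj : V ≤ j.V := ⟨_, hV₂⟩
    let l : GrassmannianIndex p r := ⟨V, i.S.image (fun f t ↦ sectionRestrict hVi (f t)) ∪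
      j.S.image (fun f t ↦ sectionRestrict hVj (f t)), by
        obtain ⟨f, hf⟩ := i.nonempty
        exact ⟨_, Finset.mem_union_left _ (Finset.mem_image_of_mem _ hf)⟩⟩
    have hli : l ≤ i := ⟨hVi, fun f hf ↦ Finset.mem_union_left _ (Finset.mem_image_of_mem _ hf)⟩
    have hlj : l ≤ j := ⟨hVj, fun f hf ↦ Finset.mem_union_right _ (Finset.mem_image_of_mem _ hf)⟩
    refine ⟨l, homOfLE hli, homOfLE hlj, ?_⟩
    have hB : (restriction hli).onBase.comp (restriction hi.le).onBase =
        (restriction hlj).onBase.comp (restriction hj.le).onBase := by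
      simp only [restriction]
      rw [← CommRingCat.hom_comp, ← CommRingCat.hom_comp, ← Functor.map_comp, ← Functor.map_comp]
      rfl
    have hM : (restriction hli).onModule.comp (restriction hi.le).onModule =
        (restriction hlj).onModule.comp (restriction hj.le).onModule := by
      simp only [restriction]
      rw [sectionRestrict_trans, sectionRestrict_trans]
    have hl : ∀ g ∈ l.S, (∃ f ∈ i.S, (fun t ↦ (restriction hli).onModule (f t)) = g) ∨
        ∃ f ∈ j.S, (fun t ↦ (restriction hlj).onModule (f t)) = g := by
      intro g hg
      rcases Finset.mem_union.mp hg with hg | hg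
      · exact Or.inl (Finset.mem_image.mp hg)
      · exact Or.inr (Finset.mem_image.mp hg)
    exact exists_prime_of_forall_field (restriction hi.le).hom (restriction hj.le).hom
      (restriction hli).hom (restriction hlj).hom (fun C _ σ₁ σ₂ h ↦
        FrameRestriction.exists_common k.nonempty (restriction hi.le) (restriction hj.le)
          (restriction hli) (restriction hlj) hB hM (restriction_isAway hj.le a₂ ha₂)
          (restriction_isAway hli _ hV₁) hl σ₁ σ₂ h) xi xj hx

lemma restriction_base {i j : GrassmannianIndex p r} (h : i ≤ j) :
    Spec.map (CommRingCat.ofHom (restriction h).hom) ≫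
      Spec.map (CommRingCat.ofHom (FrameRing.base (p.app j.V.toOpens).hom j.S)) ≫ j.V.2.fromSpec =
    Spec.map (CommRingCat.ofHom (FrameRing.base (p.app i.V.toOpens).hom i.S)) ≫
      i.V.2.fromSpec := by
  rw [← Spec.map_comp_assoc, ← CommRingCat.ofHom_comp,
    ← IsAffineOpen.map_fromSpec j.V.2 i.V.2
      (homOfLE (AffineZariskiSite.toOpens_mono h.choose)).op, ← Spec.map_comp_assoc]
  congr 2
  ext a
  exact (restriction h).hom_base a

variable (p r) in
/-- The structure maps of the charts to `X`. -/
def chartCocone : Cocone (chartFunctor p r) where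
  pt := X
  ι :=
    { app := fun i ↦ Spec.map (CommRingCat.ofHom (FrameRing.base (p.app i.V.toOpens).hom i.S)) ≫
        i.V.2.fromSpec
      naturality := fun _ _ h ↦ (restriction_base h.le).trans (Category.comp_id _).symm }

end GrassmannianIndex

variable (p r) in
/-- The Grassmannian over `X` of rank `r` locally free quotients of the quasi-coherent sheaf
`p_* 𝒪_Z`, for `p : Z ⟶ X` quasi-compact and quasi-separated: it is glued from its charts along the
open immersions between them. -/
def grassmannian [QuasiCompact p] [QuasiSeparated p] : Scheme.{u} :=
  colimit (GrassmannianIndex.chartFunctor p r)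

variable (p r) in
/-- The structure morphism of the Grassmannian. -/
def grassmannianπ [QuasiCompact p] [QuasiSeparated p] : grassmannian p r ⟶ X :=
  colimit.desc (GrassmannianIndex.chartFunctor p r) (GrassmannianIndex.chartCocone p r)

/-- The inclusion of a chart into the Grassmannian. -/
def chartι [QuasiCompact p] [QuasiSeparated p] (i : GrassmannianIndex p r) :
    Spec (.of i.ring) ⟶ grassmannian p r :=
  colimit.ι (GrassmannianIndex.chartFunctor p r) i

lemma chartι_π [QuasiCompact p] [QuasiSeparated p] (i : GrassmannianIndex p r) :
    chartι i ≫ grassmannianπ p r =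
      Spec.map (CommRingCat.ofHom (FrameRing.base (p.app i.V.toOpens).hom i.S)) ≫ i.V.2.fromSpec :=
  colimit.ι_desc (GrassmannianIndex.chartCocone p r) i

variable (p r) in
/-- If `p_* 𝒪_Z` is free over the affine open `V` with basis `b`, the section over `V` of the
Grassmannian that is given by the identity quotient of `p_* 𝒪_Z`. -/
def identitySection [QuasiCompact p] [QuasiSeparated p] (V : X.AffineZariskiSite)
    (b : letI := (p.app V.toOpens).hom.toAlgebra
      Module.Basis (Fin r) Γ(X, V.toOpens) Γ(Z, p ⁻¹ᵁ V.toOpens)) :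
    Spec Γ(X, V.toOpens) ⟶ grassmannian p r :=
  Spec.map (CommRingCat.ofHom (basisPoint (p.app V.toOpens).hom b)) ≫
    chartι ⟨V, {⇑b}, Finset.singleton_nonempty _⟩

lemma identitySection_π [QuasiCompact p] [QuasiSeparated p] (V : X.AffineZariskiSite)
    (b : letI := (p.app V.toOpens).hom.toAlgebra
      Module.Basis (Fin r) Γ(X, V.toOpens) Γ(Z, p ⁻¹ᵁ V.toOpens)) :
    identitySection p r V b ≫ grassmannianπ p r = V.2.fromSpec := by
  rw [identitySection, Category.assoc, chartι_π]
  refine (Spec.map_comp_assoc _ _ _).symm.trans ?_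
  rw [← CommRingCat.ofHom_comp]
  rw [basisPoint_comp_base]
  exact (congrArg (· ≫ V.2.fromSpec) (Spec.map_id _)).trans (Category.id_comp _)

end Grassmannian

section Nash

open Scheme

variable {K : Type u} [Field K] {X : Scheme.{u}} (f : X ⟶ Spec (.of K)) [IsSeparated f]
  [LocallyOfFiniteType f] [QuasiCompact f] (n d : ℕ)

/-- The ideal sheaf of the diagonal in `X ×ₖ X`. -/
def diagonalIdeal : (pullback f f).IdealSheafData := Hom.ker (pullback.diagonal f)

/-- The `n`-th infinitesimal neighbourhood of the diagonal: the closed subscheme of `X ×ₖ X` with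
structure sheaf `𝒪_{X × X} / I ^ (n + 1)`, where `I` is the ideal sheaf of the diagonal. -/
def infinitesimalNbhd : Scheme.{u} := IdealSheafData.subscheme (diagonalIdeal f ^ (n + 1))

/-- The first projection `p` of the `n`-th infinitesimal neighbourhood of the diagonal. The sheaf of
principal parts of order `n` of `X` is `p_* 𝒪`, that is `𝒪_{X × X} / I ^ (n + 1)` with the
`𝒪_X`-module structure from the left factor. -/
def infinitesimalNbhdFst : infinitesimalNbhd f n ⟶ X :=
  IdealSheafData.subschemeι (diagonalIdeal f ^ (n + 1)) ≫ pullback.fst f f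

instance : QuasiCompact (infinitesimalNbhdFst f n) := by
  have : QuasiCompact (IdealSheafData.subschemeι (diagonalIdeal f ^ (n + 1))) := inferInstance
  exact MorphismProperty.comp_mem _ _ _ this inferInstance
instance : QuasiSeparated (infinitesimalNbhdFst f n) := by
  have : QuasiSeparated (IdealSheafData.subschemeι (diagonalIdeal f ^ (n + 1))) := inferInstance
  exact MorphismProperty.comp_mem _ _ _ this inferInstance

/-- The Grassmannian of locally free quotients of rank `(n + d).choose d` of the sheaf of principal
parts of order `n` of `X`. -/
def principalPartsGrassmannian : Scheme.{u} :=
  grassmannian (infinitesimalNbhdFst f n) ((n + d).choose d)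

/-- The structure morphism of the Grassmannian of the sheaf of principal parts. -/
def principalPartsGrassmannianπ : principalPartsGrassmannian f n d ⟶ X :=
  grassmannianπ (infinitesimalNbhdFst f n) ((n + d).choose d)

variable (X) in
/-- The set of non-singular points. -/
def nonsingularLocus : Set X := {x | IsRegularLocalRing (X.presheaf.stalk x)}

/-- The image `σ(U)` of the non-singular locus `U` under the section `σ` of the Grassmannian over
`U` given by the identity quotient of the sheaf of principal parts, which is locally free of rank
`(n + d).choose d` on `U`. The section `σ` is described on the affine opens contained in `U` on which
the sheaf of principal parts is free of this rank; they cover `U`. -/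
def nonsingularImage : Set (principalPartsGrassmannian f n d) :=
  {z | ∃ (V : X.AffineZariskiSite)
    (b : letI := ((infinitesimalNbhdFst f n).app V.toOpens).hom.toAlgebra
      Module.Basis (Fin ((n + d).choose d)) Γ(X, V.toOpens)
        Γ(infinitesimalNbhd f n, infinitesimalNbhdFst f n ⁻¹ᵁ V.toOpens)),
    (V.toOpens : Set X) ⊆ nonsingularLocus X ∧
      z ∈ Set.range (identitySection (infinitesimalNbhdFst f n) ((n + d).choose d) V b)}

/-- The ideal sheaf of all functions vanishing on the closure of `σ(U)`. -/
def nashIdeal : (principalPartsGrassmannian f n d).IdealSheafData :=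
  IdealSheafData.vanishingIdeal ⟨closure (nonsingularImage f n d), isClosed_closure⟩

/-- The Nash blowup of order `n` of a variety `X` of dimension `d`: the closure of `σ(U)` with its
reduced scheme structure. -/
def nashBlowup : Scheme.{u} := IdealSheafData.subscheme (nashIdeal f n d)

/-- The projection of the Nash blowup of order `n` to `X`. -/
def nashBlowupπ : nashBlowup f n d ⟶ X :=
  IdealSheafData.subschemeι (nashIdeal f n d) ≫ principalPartsGrassmannianπ f n d

end Nash

section PrincipalParts

open scoped TensorProduct

/-- The module of principal parts of order `n` of a `K`-algebra `R`: the quotient of `R ⊗[K] R` by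
the `(n + 1)`-st power of the kernel of the multiplication map, an `R`-module by the left factor. -/
abbrev PrincipalParts (K R : Type u) [CommRing K] [CommRing R] [Algebra K R] (n : ℕ) : Type u :=
  (R ⊗[K] R) ⧸ KaehlerDifferential.ideal K R ^ (n + 1)

/-- The `K`-algebra structure on the local ring of a `K`-scheme at a point. -/
abbrev stalkAlgebra {K : Type u} [Field K] {X : Scheme.{u}} (f : X ⟶ Spec (.of K)) (x : X) :
    Algebra K (X.presheaf.stalk x) :=
  ((Scheme.ΓSpecIso (.of K)).inv ≫ f.appTop ≫ X.presheaf.germ ⊤ x trivial).hom.toAlgebra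

end PrincipalParts

end NashBlowup

end

/-! Put `r = (n + d).choose d` and let `R` be the local ring at `x`, with fraction field `L`. The
inverse of `π_n` followed by the inclusion into the Grassmannian is a section over all of `X`, that
is, a locally free quotient of rank `r` of the sheaf of principal parts. On a chart around the image
of `x` it has coordinates, which become a surjection `Φ` from the principal parts of `R` onto `R ^
r`. Since `R ^ r` is free, `Φ` splits, and its kernel contains all torsion because `R ^ r` is
torsion-free.

It remains to see that the kernel is torsion, which is a dimension count over `L`. As `K` is
perfect, `L` has a separating transcendence basis, with at most `d` elements; their differentials
span `Ω[L⁄K]`, so the monomials of degree at most `n` in the elements `1 ⊗ t - t ⊗ 1` span the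
principal parts of `L`. Their dimension is therefore at most `r`, and the surjection onto `L ^ r`
induced by `Φ` is bijective. An element of the kernel of `Φ` thus vanishes in the principal parts of
`L`, hence is killed by a nonzero element of `R`.

The two transfers, from an affine open to `R` and from `R` to `L`, both rest on `exists_extension`;
the dimension bound is `finrank_le`; the coordinates come from `exists_coordinates_of_section`. -/

noncomputable section

/-! ### Powers of a submodule that is spanned modulo its square -/

section Span

open scoped Pointwise

variable {L P : Type*} [CommRing L] [CommRing P] [Algebra L P]

/-- Induction on `k`: in the product of `D ^ k + I ^ (k + 1)` with `D + I ^ 2`, every term except `D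
^ (k + 1)` lies in `I ^ (k + 2)`. Here `I` is only a submodule over `L`, so `I ^ 2 ≤ I` has to be
assumed. -/
lemma Submodule.pow_le_pow_sup_pow_succ {D I : Submodule L P} (hI : I ^ 2 ≤ I) (hDI : D ≤ I)
    (h : I ≤ D ⊔ I ^ 2)
    (k : ℕ) : I ^ k ≤ D ^ k ⊔ I ^ (k + 1) := by
  induction k with
  | zero => simp
  | succ k ih =>
    calc I ^ (k + 1) = I ^ k * I := pow_succ _ _
      _ ≤ (D ^ k ⊔ I ^ (k + 1)) * (D ⊔ I ^ 2) := mul_le_mul' ih h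
      _ ≤ D ^ (k + 1) ⊔ I ^ (k + 1 + 1) := by
        rw [Submodule.sup_mul, Submodule.mul_sup, Submodule.mul_sup]
        refine sup_le (sup_le (le_sup_of_le_left (pow_succ D k).ge) ?_) (sup_le ?_ ?_) <;>
          refine le_sup_of_le_right ?_
        · calc D ^ k * I ^ 2 ≤ I ^ k * I ^ 2 := mul_le_mul_left (pow_le_pow_left' hDI k) _
            _ = _ := by ring
        · calc I ^ (k + 1) * D ≤ I ^ (k + 1) * I := mul_le_mul_right hDI _
            _ = _ := by ring
        · calc I ^ (k + 1) * I ^ 2 ≤ I ^ (k + 1) * I := mul_le_mul_right hI _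
            _ = _ := by ring

/-- If `P = L + I` and `I` is spanned by `D` modulo `I ^ 2`, then `P` is spanned by `(L + D) ^ k`
modulo `I ^ (k + 1)`. -/
lemma Submodule.top_le_one_sup_pow {D I : Submodule L P} (hI : I ^ 2 ≤ I) (hDI : D ≤ I)
    (h : I ≤ D ⊔ I ^ 2)
    (h1 : (⊤ : Submodule L P) ≤ 1 ⊔ I) (k : ℕ) : ⊤ ≤ (1 ⊔ D) ^ k ⊔ I ^ (k + 1) := by
  induction k with
  | zero => simpa using h1
  | succ k ih =>
    refine ih.trans (sup_le ?_ ((pow_le_pow_sup_pow_succ hI hDI h (k + 1)).trans ?_))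
    · exact le_sup_of_le_left (pow_le_pow_right' le_sup_left (Nat.le_succ k))
    · exact sup_le_sup_right (pow_le_pow_left' le_sup_right _) _

/-- By commutativity a `k`-fold product of generators depends only on the multiset of its factors.
Indexing by `Sym ι k` rather than by tuples is what later gives the sharp count. -/
lemma Submodule.exists_span_eq_span_range_pow {ι : Type*} (v : ι → P) (k : ℕ) :
    ∃ w : Sym ι k → P, Submodule.span L (Set.range v) ^ k ≤ Submodule.span L (Set.range w) := by
  refine ⟨fun m ↦ ((m : Multiset ι).map v).prod, ?_⟩
  rw [Submodule.span_pow]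
  refine Submodule.span_mono fun x hx ↦ ?_
  obtain ⟨f, rfl⟩ := Set.mem_pow.mp hx
  choose g hg using fun i ↦ (f i).2
  refine ⟨Sym.ofVector ⟨List.ofFn g, by simp⟩, ?_⟩
  change (Multiset.map v (List.ofFn g : Multiset ι)).prod = _
  simp [List.map_ofFn, Function.comp_def, hg]

end Span

/-! ### Principal parts and localization -/

namespace NashBlowup

open scoped TensorProduct

namespace PrincipalParts

section Localization

variable (K : Type u) [CommRing K] {A R : Type u} [CommRing A] [CommRing R] [Algebra K A]
  [Algebra K R] (n : ℕ)

/-- The class of `a ⊗ b`. -/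
abbrev tmul (a b : R) : PrincipalParts K R n := Ideal.Quotient.mk _ (a ⊗ₜ b)

lemma smul_tmul (c a b : R) : c • tmul K n a b = tmul K n (c * a) b := rfl

/-- Thanks to this, inverting `a ⊗ 1` also inverts `1 ⊗ a`, so localizing on the left localizes both
factors. -/
lemma isNilpotent_sub (a : R) : IsNilpotent (tmul K n 1 a - tmul K n a 1) := by
  refine ⟨n + 1, ?_⟩
  rw [tmul, tmul, ← map_sub, ← map_pow, Ideal.Quotient.eq_zero_iff_mem]
  exact Ideal.pow_mem_pow (KaehlerDifferential.one_smul_sub_smul_one_mem_ideal K a) _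

/-- The ring homomorphism from principal parts given by a pair of ring homomorphisms that agree modulo
an ideal with vanishing `n + 1`-st power. -/
lemma exists_lift {C : Type*} [CommRing C] [Algebra K C] (l r : R →ₐ[K] C) (J : Ideal C)
    (hJ : J ^ (n + 1) = ⊥) (h : ∀ a, r a - l a ∈ J) :
    ∃ g : PrincipalParts K R n →+* C, ∀ a b, g (tmul K n a b) = l a * r b := by
  let G : R ⊗[K] R →ₐ[K] C := Algebra.TensorProduct.lift l r fun _ _ ↦ Commute.all _ _
  have hG : KaehlerDifferential.ideal K R ≤ J.comap G := by
    rw [← KaehlerDifferential.span_range_eq_ideal, Ideal.span_le]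
    rintro _ ⟨a, rfl⟩
    simpa [G] using h a
  refine ⟨Ideal.Quotient.lift _ (G : R ⊗[K] R →+* C) fun x hx ↦ ?_, fun a b ↦ by simp [tmul, G]⟩
  have := (Ideal.pow_right_mono hG (n + 1)).trans (Ideal.le_comap_pow G (n + 1)) hx
  simpa [hJ] using this

variable [Algebra A R] [IsScalarTower K A R]

lemma smul_eq_tmul_mul (a : A) (x : PrincipalParts K R n) :
    a • x = tmul K n (algebraMap A R a) 1 * x := by
  rw [Algebra.smul_def]
  rfl

variable (A R) in
/-- The base change homomorphism of principal parts. -/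
def mapRingHom : PrincipalParts K A n →+* PrincipalParts K R n :=
  Ideal.quotientMap _ (Algebra.TensorProduct.map (IsScalarTower.toAlgHom K A R)
    (IsScalarTower.toAlgHom K A R)).toRingHom <| by
      have : KaehlerDifferential.ideal K A ≤ (KaehlerDifferential.ideal K R).comap
          (Algebra.TensorProduct.map (IsScalarTower.toAlgHom K A R)
            (IsScalarTower.toAlgHom K A R)).toRingHom := by
        rw [← KaehlerDifferential.span_range_eq_ideal, Ideal.span_le]
        rintro _ ⟨a, rfl⟩
        simp [RingHom.mem_ker]
      exact (Ideal.pow_right_mono this (n + 1)).trans (Ideal.le_comap_pow _ (n + 1))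

variable (A R) in
/-- The base change map of principal parts. -/
def map : PrincipalParts K A n →ₗ[A] PrincipalParts K R n where
  toFun := mapRingHom K A R n
  map_add' := map_add _
  map_smul' a x := by
    rw [RingHom.id_apply, smul_eq_tmul_mul, smul_eq_tmul_mul, map_mul]
    congr 1
    change tmul K n (algebraMap A R a) (algebraMap A R 1) = _
    rw [map_one]

lemma linearMap_ext {Q : Type*} [AddCommGroup Q] [Module A Q] {φ ψ : PrincipalParts K A n →ₗ[A] Q}
    (h : ∀ b, φ (tmul K n 1 b) = ψ (tmul K n 1 b)) : φ = ψ := by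
  refine LinearMap.ext fun x ↦ ?_
  obtain ⟨x, rfl⟩ := Ideal.Quotient.mk_surjective x
  induction x with
  | zero => simp
  | add x y hx hy => simp only [map_add, hx, hy]
  | tmul a b =>
    change φ (tmul K n a b) = ψ (tmul K n a b)
    rw [← mul_one a, ← smul_tmul, map_smul, map_smul, h]

/-- The principal parts of a localization `R` of `A` map to the corresponding localization `C` of the
principal parts of `A`. -/
lemma exists_ringHom_localization (M : Submonoid A) [IsLocalization M R] {C : Type u} [CommRing C]
    [Algebra (PrincipalParts K A n) C] [Algebra K C] [IsScalarTower K (PrincipalParts K A n) C]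
    [IsLocalization (Algebra.algebraMapSubmonoid (PrincipalParts K A n) M) C] :
    ∃ (l : R →+* C) (g : PrincipalParts K R n →+* C),
      (∀ a, l (algebraMap A R a) = algebraMap _ C (tmul K n a 1)) ∧
      (∀ a, g (tmul K n a 1) = l a) ∧
      ∀ b, g (tmul K n 1 (algebraMap A R b)) = algebraMap _ C (tmul K n 1 b) := by
  let P := PrincipalParts K A n
  have hN (m : M) : IsUnit (algebraMap P C (tmul K n m 1)) :=
    IsLocalization.map_units C (⟨_, m, m.2, rfl⟩ : Algebra.algebraMapSubmonoid P M)
  let l₀ : A →ₐ[K] C := (IsScalarTower.toAlgHom K P C).comp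
    ((Ideal.Quotient.mkₐ K _).comp Algebra.TensorProduct.includeLeft)
  let r₀ : A →ₐ[K] C := (IsScalarTower.toAlgHom K P C).comp
    ((Ideal.Quotient.mkₐ K _).comp Algebra.TensorProduct.includeRight)
  have hl₀ (a : A) : l₀ a = algebraMap P C (tmul K n a 1) := rfl
  have hr₀ (a : A) : r₀ a = algebraMap P C (tmul K n 1 a) := rfl
  have hl (m : M) : IsUnit (l₀ m) := hN m
  -- A unit plus a nilpotent element is a unit.
  have hr (m : M) : IsUnit (r₀ m) := by
    have := ((isNilpotent_sub K n (m : A)).map (algebraMap P C)).isUnit_add_left_of_commute (hN m)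
      (Commute.all _ _)
    rwa [← map_add, add_sub_cancel] at this
  let l : R →ₐ[K] C := IsLocalization.liftAlgHom (M := M) (f := l₀) hl
  let r : R →ₐ[K] C := IsLocalization.liftAlgHom (M := M) (f := r₀) hr
  have hla (a : A) : l (algebraMap A R a) = l₀ a := IsLocalization.lift_eq hl a
  have hra (a : A) : r (algebraMap A R a) = r₀ a := IsLocalization.lift_eq hr a
  let J₀ : Ideal P := (KaehlerDifferential.ideal K A).map (Ideal.Quotient.mk _)
  have hJ₀ (a : A) : tmul K n 1 a - tmul K n a 1 ∈ J₀ :=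
    Ideal.mem_map_of_mem _ (KaehlerDifferential.one_smul_sub_smul_one_mem_ideal K a)
  have hJ : (J₀.map (algebraMap P C)) ^ (n + 1) = ⊥ := by
    rw [← Ideal.map_pow, ← Ideal.map_pow, Ideal.map_quotient_self, Ideal.map_bot]
  have hlr₀ (a : A) : r₀ a - l₀ a ∈ J₀.map (algebraMap P C) := by
    rw [hl₀, hr₀, ← map_sub]
    exact Ideal.mem_map_of_mem _ (hJ₀ a)
  -- Write `a = b / m`. Multiplying the difference of fractions by the unit `l₀ m * r₀ m` clears
  -- denominators and leaves a combination of differences coming from `A`.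
  have hlr (a : R) : r a - l a ∈ J₀.map (algebraMap P C) := by
    obtain ⟨⟨b, m⟩, hb⟩ := IsLocalization.surj M a
    refine (Ideal.unit_mul_mem_iff_mem _ ((hl m).mul (hr m))).mp ?_
    have h1 := congrArg l hb
    have h2 := congrArg r hb
    rw [map_mul, hla, hla] at h1
    rw [map_mul, hra, hra] at h2
    have : l₀ m * r₀ m * (r a - l a) = l₀ m * (r₀ b - l₀ b) - l₀ b * (r₀ m - l₀ m) := by
      linear_combination l₀ m * h2 - r₀ m * h1
    rw [this]
    exact sub_mem (Ideal.mul_mem_left _ _ (hlr₀ _)) (Ideal.mul_mem_left _ _ (hlr₀ _))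
  obtain ⟨g, hg⟩ := exists_lift K n l r _ hJ hlr
  exact ⟨l, g, hla, fun a ↦ by rw [hg, map_one, mul_one]; rfl,
    fun b ↦ by rw [hg, map_one, one_mul, hra, hr₀]⟩

/-- The extension factors through `C`, the localization of the principal parts of `A`: these are
mapped to by the principal parts of `R`, and `φ` extends to `C` because `M` acts invertibly on the
`R`-module `Q`. -/
lemma exists_extension_of_isLocalization (M : Submonoid A) [IsLocalization M R] (C : Type u)
    [CommRing C] [Algebra (PrincipalParts K A n) C] [Algebra K C]
    [IsScalarTower K (PrincipalParts K A n) C] [Algebra A C]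
    [IsScalarTower A (PrincipalParts K A n) C]
    [IsLocalization (Algebra.algebraMapSubmonoid (PrincipalParts K A n) M) C]
    {Q : Type*} [AddCommGroup Q] [Module A Q] [Module R Q]
    [IsScalarTower A R Q] (φ : PrincipalParts K A n →ₗ[A] Q) :
    ∃ Φ : PrincipalParts K R n →ₗ[R] Q, Φ.restrictScalars A ∘ₗ map K A R n = φ := by
  let P := PrincipalParts K A n
  obtain ⟨l, g, hl, hgl, hg⟩ := exists_ringHom_localization K n M (R := R) (C := C)
  let : Algebra R C := l.toAlgebra
  have : IsScalarTower A R C := .of_algebraMap_eq fun a ↦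
    (IsScalarTower.algebraMap_apply A P C a).trans (hl a).symm
  have hQ (m : M) : IsUnit (algebraMap A (Module.End A Q) m) := by
    have := (IsLocalization.map_units R m).map (Module.toModuleEnd A (S := R) Q)
    convert this
    ext q
    simp
  let e : C →ₗ[A] Q := IsLocalizedModule.lift M (IsScalarTower.toAlgHom A P C).toLinearMap φ hQ
  let g' : PrincipalParts K R n →ₗ[R] C :=
    { toFun := g
      map_add' := map_add g
      map_smul' := fun a x ↦ by
        have : a • x = tmul K n a 1 * x := by
          rw [Algebra.smul_def]; rfl
        rw [this, map_mul, hgl, Algebra.smul_def]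
        rfl }
  -- An `A`-linear map between modules over the localization `R` is automatically `R`-linear.
  refine ⟨e.extendScalarsOfIsLocalization M R ∘ₗ g', linearMap_ext K n fun b ↦ ?_⟩
  change e (g (tmul K n (algebraMap A R 1) (algebraMap A R b))) = _
  rw [map_one, hg]
  exact IsLocalizedModule.lift_apply M (IsScalarTower.toAlgHom A P C).toLinearMap φ hQ _

/-- A linear map from the principal parts of `A` to an `R`-module extends to the principal parts of the
localization `R` of `A`. -/
theorem exists_extension (M : Submonoid A) [IsLocalization M R]
    {Q : Type*} [AddCommGroup Q] [Module A Q] [Module R Q]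
    [IsScalarTower A R Q] (φ : PrincipalParts K A n →ₗ[A] Q) :
    ∃ Φ : PrincipalParts K R n →ₗ[R] Q, Φ.restrictScalars A ∘ₗ map K A R n = φ :=
  exists_extension_of_isLocalization K n M
    (Localization (Algebra.algebraMapSubmonoid (PrincipalParts K A n) M)) φ

/-- The localization map of the `A`-module of principal parts extends to the principal parts of `R`.
So an element dying there already dies in the module localization, whose kernel is the `M`-torsion.
-/
lemma exists_smul_eq_zero_of_map_eq_zero (M : Submonoid A) [IsLocalization M R]
    (x : PrincipalParts K A n) (hx : map K A R n x = 0) :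
    ∃ m : M, m • x = 0 := by
  obtain ⟨Φ, hΦ⟩ := exists_extension K n M (R := R) (TensorProduct.mk A R (PrincipalParts K A n) 1)
  have h := congrArg (fun s ↦ s x) hΦ
  simp only [LinearMap.comp_apply, hx, map_zero] at h
  exact (IsLocalizedModule.eq_zero_iff M (TensorProduct.mk A R (PrincipalParts K A n) 1)).mp h.symm

end Localization

end PrincipalParts
end NashBlowup

/-! ### Generators of the principal parts -/

namespace NashBlowup

open scoped TensorProduct

namespace PrincipalParts

variable (K : Type u) [CommRing K] {L : Type u} [CommRing L] [Algebra K L] (n : ℕ) {d : ℕ}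

/-- If the differentials of `d` elements span the Kähler differentials, then the principal parts of
order `n` are spanned by the monomials of degree `n` in `d + 1` elements. -/
theorem exists_span_range_eq_top (t : Fin d → L)
    (ht : ⊤ ≤ Submodule.span L (Set.range fun i ↦ KaehlerDifferential.D K L (t i))) :
    ∃ w : Sym (Fin (d + 1)) n → PrincipalParts K L n, ⊤ ≤ Submodule.span L (Set.range w) := by
  let J := KaehlerDifferential.ideal K L
  let δ (i : Fin d) : L ⊗[K] L := 1 ⊗ₜ t i - t i ⊗ₜ 1
  let I := J.restrictScalars L
  have hδ (i : Fin d) : δ i ∈ J := KaehlerDifferential.one_smul_sub_smul_one_mem_ideal K (t i)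
  let D := Submodule.span L (Set.range δ)
  have hDI : D ≤ I := Submodule.span_le.mpr (Set.range_subset_iff.mpr hδ)
  -- The exponent must be nonzero: the zeroth power of an `L`-submodule is the image of `L`, while
  -- that of an ideal is the whole ring.
  have hI2 : J.restrictScalars L ^ 2 = (J ^ 2).restrictScalars L :=
    (Submodule.restrictScalars_pow two_ne_zero).symm
  have hI : I ^ 2 ≤ I := by
    rw [hI2]
    exact Ideal.pow_le_self two_ne_zero
  have h1 : (⊤ : Submodule L (L ⊗[K] L)) ≤ 1 ⊔ I := by
    intro x _
    refine Submodule.mem_sup.mpr ⟨_, Submodule.algebraMap_mem (Algebra.TensorProduct.lmul' K x),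
      x - algebraMap L _ (Algebra.TensorProduct.lmul' K x), ?_, add_sub_cancel _ _⟩
    simp [I, J, RingHom.mem_ker]
  -- `Ω[L⁄K]` is `J / J ^ 2`, and the class of `δ i` is the differential of `t i`. Equal
  -- differentials therefore mean equality modulo `J ^ 2`.
  have h : I ≤ D ⊔ I ^ 2 := by
    intro x hx
    let q : J →ₗ[L] Ω[L⁄K] := (KaehlerDifferential.fromIdeal K L).restrictScalars L
    obtain ⟨y, hy, hyx⟩ : q ⟨x, hx⟩ ∈ (Submodule.span L (Set.range fun i ↦ ⟨δ i, hδ i⟩)).map q := by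
      rw [Submodule.map_span, ← Set.range_comp]
      exact ht trivial
    have hxy : x - y ∈ I ^ 2 := by
      rw [hI2]
      exact (Ideal.toCotangent_eq J).mp hyx.symm
    refine Submodule.mem_sup.mpr ⟨y, ?_, x - y, hxy, add_sub_cancel _ _⟩
    have := Submodule.mem_map_of_mem (f := (J.subtype).restrictScalars L) hy
    rwa [Submodule.map_span, ← Set.range_comp] at this
  have key := Submodule.top_le_one_sup_pow hI hDI h h1 n
  -- Adding `1` to the generators homogenizes: monomials of degree at most `n` in the `δ i` become
  -- monomials of degree exactly `n` in `d + 1` elements.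
  have hv : 1 ⊔ D = Submodule.span L (Set.range (Fin.cons 1 δ : Fin (d + 1) → L ⊗[K] L)) := by
    rw [Fin.range_cons, Submodule.span_insert, Submodule.one_eq_span]
  obtain ⟨w, hw⟩ := Submodule.exists_span_eq_span_range_pow (L := L)
    (Fin.cons 1 δ : Fin (d + 1) → L ⊗[K] L) n
  refine ⟨fun m ↦ Ideal.Quotient.mk _ (w m), fun x _ ↦ ?_⟩
  obtain ⟨x, rfl⟩ := Ideal.Quotient.mk_surjective x
  obtain ⟨y, hy, z, hz, rfl⟩ := Submodule.mem_sup.mp (key (x := x) trivial)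
  rw [← Submodule.restrictScalars_pow n.succ_ne_zero] at hz
  rw [map_add, Ideal.Quotient.eq_zero_iff_mem.mpr hz, add_zero]
  rw [hv] at hy
  have := Submodule.mem_map_of_mem (f := (Ideal.Quotient.mkₐ L (J ^ (n + 1))).toLinearMap) (hw hy)
  rwa [Submodule.map_span, ← Set.range_comp] at this

end PrincipalParts

/-! ### Separating transcendence bases and Krull dimension -/

section Dimension

open KaehlerDifferential

/-- A finitely generated extension of a perfect field has a transcendence basis whose differentials
span the Kähler differentials. -/
theorem exists_isTranscendenceBasis_span_D (K L : Type*) [Field K] [Field L] [Algebra K L]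
    [PerfectField K] [Algebra.EssFiniteType K L] :
    ∃ s : Finset L, IsTranscendenceBasis K ((↑) : s → L) ∧
      ⊤ ≤ Submodule.span L (D K L '' s) := by
  obtain ⟨s, hs, hsep⟩ := exists_isTranscendenceBasis_and_isSeparable_of_perfectField K L
  refine ⟨s, hs, ?_⟩
  let F := IntermediateField.adjoin K (s : Set L)
  -- `L` is separable over the field `F` generated by the basis, so `Ω[L⁄F] = 0` and `Ω[L⁄K]` comes
  -- entirely from differentials of `F`. Those are reduced to the basis by the Leibniz and quotient
  -- rules.
  have := Algebra.FormallyUnramified.of_isSeparable F L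
  have hF (x : L) (hx : x ∈ F) : D K L x ∈ Submodule.span L (D K L '' s) := by
    induction hx using IntermediateField.adjoin_induction with
    | mem x hx => exact Submodule.subset_span ⟨x, hx, rfl⟩
    | algebraMap x => simp
    | add x y _ _ hx hy => rw [map_add]; exact add_mem hx hy
    | inv x _ hx => rw [Derivation.leibniz_inv]; exact Submodule.smul_mem _ _ hx
    | mul x y _ _ hx hy =>
      rw [Derivation.leibniz]
      exact add_mem (Submodule.smul_mem _ _ hy) (Submodule.smul_mem _ _ hx)
  rintro x -
  obtain ⟨y, rfl⟩ := (exact_mapBaseChange_map K F L x).mp (Subsingleton.elim _ _)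
  induction y with
  | zero => simp
  | add y z hy hz => rw [map_add]; exact add_mem hy hz
  | tmul a ω =>
    rw [mapBaseChange_tmul]
    refine Submodule.smul_mem _ _ ?_
    have : ω ∈ Submodule.span F (Set.range (D K F)) := by rw [span_range_derivation]; trivial
    induction this using Submodule.span_induction with
    | mem ω h =>
      obtain ⟨c, rfl⟩ := h
      rw [map_D]
      exact hF _ c.2
    | zero => simp
    | add y z _ _ hy hz => rw [map_add]; exact add_mem hy hz
    | smul c y _ hy =>
      rw [map_smul, ← algebraMap_smul L c]
      exact Submodule.smul_mem _ _ hy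

/-- Lying over provides a prime above the bottom of a chain in `R`, and going up lifts the rest of
the chain with the same length. -/
lemma ringKrullDim_le_of_isIntegral_of_injective {R S : Type*} [CommRing R] [CommRing S]
    [Algebra R S]
    [Algebra.IsIntegral R S] (h : Function.Injective (algebraMap R S)) :
    ringKrullDim R ≤ ringKrullDim S := by
  refine iSup_le fun l ↦ ?_
  have := Algebra.HasGoingUp.of_isIntegral (R := R) (S := S)
  obtain ⟨Q, -, hQ, hQl⟩ := Ideal.exists_ideal_over_prime_of_isIntegral l.head.asIdeal (⊥ : Ideal S)
    (by rw [← RingHom.ker_eq_comap_bot, (RingHom.injective_iff_ker_eq_bot _).mp h]; exact bot_le)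
  have : Q.LiesOver l.head.asIdeal := ⟨hQl.symm⟩
  obtain ⟨l', hl', -⟩ := Ideal.exists_ltSeries_of_hasGoingUp l Q
  rw [← hl']
  exact Order.LTSeries.length_le_krullDim l'

/-- By Noether normalization `A` is integral over a polynomial ring in `m` variables, so `m ≤ dim
A`. The variables form a transcendence basis of `L`, so `m` is the size of `s`. -/
lemma card_le_ringKrullDim {K A L : Type*} [Field K] [CommRing A] [IsDomain A] [Field L] [Algebra K A]
    [Algebra K L] [Algebra A L] [IsScalarTower K A L] [IsFractionRing A L] [Algebra.FiniteType K A]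
    {s : Finset L} (hs : IsTranscendenceBasis K ((↑) : s → L)) : s.card ≤ ringKrullDim A := by
  obtain ⟨m, g, hg, hgi⟩ := exists_integral_inj_algHom_of_fg K A
  let := g.toRingHom.toAlgebra
  let := ((algebraMap A L).comp g.toRingHom).toAlgebra
  have : IsScalarTower (MvPolynomial (Fin m) K) A L := .of_algebraMap_eq fun _ ↦ rfl
  have : IsScalarTower K (MvPolynomial (Fin m) K) A := .of_algebraMap_eq fun a ↦ (g.commutes a).symm
  have : Algebra.IsIntegral (MvPolynomial (Fin m) K) A := ⟨hgi⟩
  have h1 := ringKrullDim_le_of_isIntegral_of_injective (R := MvPolynomial (Fin m) K) (S := A) hg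
  rw [MvPolynomial.ringKrullDim_of_isNoetherianRing, ringKrullDim_eq_zero_of_field, zero_add,
    Nat.card_fin] at h1
  have : IsScalarTower K (MvPolynomial (Fin m) K) L := .of_algebraMap_eq fun a ↦ by
    rw [IsScalarTower.algebraMap_apply K A L,
      IsScalarTower.algebraMap_apply K (MvPolynomial (Fin m) K) A]
    rfl
  have : FaithfulSMul (MvPolynomial (Fin m) K) L := (faithfulSMul_iff_algebraMap_injective _ _).mpr
    ((IsFractionRing.injective A L).comp hg)
  have : Algebra.IsAlgebraic A L := IsLocalization.isAlgebraic L (nonZeroDivisors A)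
  have : Algebra.IsAlgebraic (MvPolynomial (Fin m) K) L := .trans _ A _
  have h2 := hs.lift_cardinalMk_eq ((IsTranscendenceBasis.mvPolynomial (Fin m) K).algebraMap_comp (A := L))
  have h3 : s.card = m := by simpa using h2
  exact h3 ▸ h1

end Dimension
end NashBlowup

/-! ### Splitting off the torsion -/

namespace NashBlowup

/-- The free target makes `Φ` split. Torsion maps to zero in `R ^ r`, so the kernel is exactly the
torsion and is the complement of the free summand. -/
lemma nonempty_linearEquiv_prod_torsion {R P : Type*} [CommRing R] [IsDomain R] [AddCommGroup P]
    [Module R P] {r : ℕ} (Φ : P →ₗ[R] Fin r → R) (hΦ : Function.Surjective Φ)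
    (h : LinearMap.ker Φ ≤ Submodule.torsion R P) :
    Nonempty (P ≃ₗ[R] (Fin r → R) × Submodule.torsion R P) := by
  obtain ⟨s, hs⟩ := Module.projective_lifting_property Φ LinearMap.id hΦ
  replace hs (y) : Φ (s y) = y := congrArg (fun f ↦ f y) hs
  have h' (x) (hx : x ∈ Submodule.torsion R P) : Φ x = 0 := by
    obtain ⟨a, ha⟩ := (Submodule.mem_torsion_iff x).mp hx
    have : (a : R) • Φ x = 0 := by rw [← map_smul]; exact (congrArg Φ ha).trans (map_zero Φ)
    exact (smul_eq_zero.mp this).resolve_left (nonZeroDivisors.coe_ne_zero a)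
  refine ⟨(LinearEquiv.ofBijective (s.coprod (Submodule.torsion R P).subtype) ⟨?_, fun x ↦ ?_⟩).symm⟩
  · rw [← LinearMap.ker_eq_bot, LinearMap.ker_eq_bot']
    rintro ⟨y, x, hx⟩ hyx
    have hyx' : s y + x = 0 := by simpa using hyx
    have hy : y = 0 := by simpa [hs, h' x hx] using congrArg Φ hyx'
    subst hy
    simpa using hyx'
  · exact ⟨(Φ x, ⟨x - s (Φ x), h (by simp [hs])⟩), by simp⟩

namespace PrincipalParts

variable (K : Type u) [Field K] (n : ℕ) {d : ℕ}

lemma finrank_le {L : Type u} [Field L] [Algebra K L] (t : Fin d → L)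
    (ht : ⊤ ≤ Submodule.span L (Set.range fun i ↦ KaehlerDifferential.D K L (t i))) :
    Module.Finite L (PrincipalParts K L n) ∧
      Module.finrank L (PrincipalParts K L n) ≤ (n + d).choose d := by
  classical
  obtain ⟨w, hw⟩ := exists_span_range_eq_top K n t ht
  rw [top_le_iff] at hw
  refine ⟨⟨Submodule.fg_def.mpr ⟨_, Set.finite_range w, hw⟩⟩, ?_⟩
  rw [← finrank_top, ← hw]
  refine (finrank_range_le_card w).trans_eq ?_
  -- There are `(d + 1 + n - 1).choose n` multisets of size `n` in `d + 1` letters.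
  rw [Sym.card_sym_eq_multichoose, Fintype.card_fin, Nat.multichoose_eq, ← Nat.choose_symm_add]
  congr 1
  lia

/-- If the Kähler differentials of the fraction field of `R` are spanned by `d` differentials, then a
free quotient of rank `(n + d).choose d` of the principal parts of order `n` of `R` splits off, and
the complement is the torsion. -/
theorem nonempty_linearEquiv_of_surjective {R L : Type u} [CommRing R] [IsDomain R] [Algebra K R]
    [Field L] [Algebra R L] [IsFractionRing R L] [Algebra K L] [IsScalarTower K R L] (t : Fin d → L)
    (ht : ⊤ ≤ Submodule.span L (Set.range fun i ↦ KaehlerDifferential.D K L (t i)))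
    (Φ : PrincipalParts K R n →ₗ[R] Fin ((n + d).choose d) → R) (hΦ : Function.Surjective Φ) :
    Nonempty (PrincipalParts K R n ≃ₗ[R]
      (Fin ((n + d).choose d) → R) × Submodule.torsion R (PrincipalParts K R n)) := by
  obtain ⟨hfin, hrank⟩ := finrank_le K n t ht
  obtain ⟨Ψ, hΨ⟩ := exists_extension K n (R := L) (nonZeroDivisors R)
    ((Algebra.linearMap R L).compLeft (Fin ((n + d).choose d)) ∘ₗ Φ)
  replace hΨ (x) : Ψ (map K R L n x) = fun i ↦ algebraMap R L (Φ x i) := congrArg (fun f ↦ f x) hΨ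
  have hsurj : Function.Surjective Ψ := by
    rw [← LinearMap.range_eq_top, ← top_le_iff, ← (Pi.basisFun L _).span_eq, Submodule.span_le]
    rintro _ ⟨i, rfl⟩
    obtain ⟨x, hx⟩ := hΦ (Pi.single i 1)
    refine ⟨map K R L n x, ?_⟩
    rw [hΨ, hx]
    ext j
    by_cases h : j = i
    · subst h; simp
    · simp [h]
  -- The source has dimension at most that of the target, so surjectivity forces bijectivity.
  have hinj : Function.Injective Ψ := by
    refine (LinearMap.injective_iff_surjective_of_finrank_eq_finrank ?_).mpr hsurj
    refine le_antisymm (by simpa using hrank) (LinearMap.finrank_le_finrank_of_surjective hsurj)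
  refine nonempty_linearEquiv_prod_torsion Φ hΦ fun x hx ↦ ?_
  refine (Submodule.mem_torsion_iff x).mpr (exists_smul_eq_zero_of_map_eq_zero K n (R := L)
    (nonZeroDivisors R) x (hinj ?_))
  rw [hΨ, LinearMap.mem_ker.mp hx, map_zero]
  ext
  simp

/-- If `R` is a localization of a finitely generated domain `A` of dimension at most `d`, then a free
quotient of rank `(n + d).choose d` of the principal parts of order `n` of `A`, with values in `R`,
splits off the principal parts of `R`, and the complement is the torsion. -/
theorem nonempty_linearEquiv_of_localization [PerfectField K] {A R L : Type u} [CommRing A]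
    [CommRing R] [IsDomain A] [IsDomain R] [Field L] [Algebra K A] [Algebra K R] [Algebra K L]
    [Algebra A R] [Algebra A L] [Algebra R L] [IsScalarTower K A R] [IsScalarTower K A L]
    [IsScalarTower K R L] [IsFractionRing R L] [IsFractionRing A L] [Algebra.FiniteType K A]
    (M : Submonoid A) [IsLocalization M R] (hd : ringKrullDim A ≤ d)
    (φ : PrincipalParts K A n →ₗ[A] Fin ((n + d).choose d) → R)
    (hφ : ∀ i, Pi.single i 1 ∈ Set.range φ) :
    Nonempty (PrincipalParts K R n ≃ₗ[R]
      (Fin ((n + d).choose d) → R) × Submodule.torsion R (PrincipalParts K R n)) := by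
  have : Algebra.EssFiniteType A L := .of_isLocalization L (nonZeroDivisors A)
  have : Algebra.EssFiniteType K L := .comp K A L
  obtain ⟨s, hs, hspan⟩ := exists_isTranscendenceBasis_span_D K L
  have hsd : s.card ≤ d := by exact_mod_cast (card_le_ringKrullDim (A := A) hs).trans hd
  obtain ⟨Φ, hΦ⟩ := exists_extension K n (R := R) M φ
  refine nonempty_linearEquiv_of_surjective K n (L := L)
    -- Only `s.card ≤ d` has been established, so the basis is padded with zeros to a family of
    -- length `d`; enlarging the family does not harm spanning.
    (fun i : Fin d ↦ if h : i.1 < s.card then (s.equivFin.symm ⟨i, h⟩ : L) else 0)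
    (hspan.trans (Submodule.span_mono ?_)) Φ ?_
  · rintro _ ⟨x, hx, rfl⟩
    refine ⟨⟨s.equivFin ⟨x, hx⟩, (s.equivFin ⟨x, hx⟩).2.trans_le hsd⟩, ?_⟩
    simp
  · rw [← LinearMap.range_eq_top, ← top_le_iff, ← (Pi.basisFun R _).span_eq, Submodule.span_le]
    rintro _ ⟨i, rfl⟩
    obtain ⟨x, hx⟩ := hφ i
    refine ⟨map K A R n x, ?_⟩
    rw [Pi.basisFun_apply, ← hx, ← hΦ]
    rfl

end PrincipalParts
end NashBlowup

/-! ### The sheaf of principal parts over an affine open -/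

namespace NashBlowup

open Scheme

/-- The intersection is the fibre product of the affine schemes `UX` and `UT` over the affine scheme
`S`. -/
lemma isAffineOpen_inf_of_isPullback {X Y S T : Scheme.{u}} {f : T ⟶ S} {g : Y ⟶ X} {iX : X ⟶ S}
    {iY : Y ⟶ T} (H : IsPullback g iY iX f) [IsAffine S] {UT : T.Opens} {UX : X.Opens}
    (hUT : IsAffineOpen UT) (hUX : IsAffineOpen UX) : IsAffineOpen (g ⁻¹ᵁ UX ⊓ iY ⁻¹ᵁ UT) := by
  have : IsAffine _ := hUT
  have : IsAffine _ := hUX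
  have : IsAffine _ := isAffineOpen_top S
  have H' := Scheme.Hom.isPullback_resLE H (US := ⊤) (UT := UT) (UX := UX) le_top le_top rfl
  exact .of_isIso H'.isoPullback.hom

section Neighbourhood

variable {K : Type u} [Field K] {X : Scheme.{u}} (f : X ⟶ Spec (.of K))

/-- The `K`-algebra structure on the sections of a `K`-scheme. -/
abbrev sectionsAlgebra (V : X.Opens) : Algebra K Γ(X, V) :=
  ((Scheme.ΓSpecIso (.of K)).inv ≫ f.appLE ⊤ V le_top).hom.toAlgebra

/-- The open subscheme `V × V` of `X × X`. -/
def squareOpens (V : X.Opens) : (pullback f f).Opens :=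
  pullback.fst f f ⁻¹ᵁ V ⊓ pullback.snd f f ⁻¹ᵁ V

variable {f}

lemma isAffineOpen_squareOpens {V : X.Opens} (hV : IsAffineOpen V) :
    IsAffineOpen (squareOpens f V) :=
  isAffineOpen_inf_of_isPullback (IsPullback.of_hasPullback f f) hV hV

lemma isPushout_squareOpens {V : X.Opens} (hV : IsAffineOpen V) :
    IsPushout (f.appLE ⊤ V le_top) (f.appLE ⊤ V le_top)
      ((pullback.fst f f).appLE V (squareOpens f V) inf_le_left)
      ((pullback.snd f f).appLE V (squareOpens f V) inf_le_right) :=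
  (isIso_pushoutSection_iff (IsPullback.of_hasPullback f f) le_top le_top rfl).mp
    (isIso_pushoutSection_of_isAffineOpen _ _ _ _ (isAffineOpen_top _) hV hV)

/-- The sections over `V × V` form a pushout of rings, hence are generated by the images of the two
factors. Surjectivity of `θ` suffices, since only a quotient of the principal parts is needed. -/
lemma exists_tensorProduct_squareOpens {V : X.Opens} (hV : IsAffineOpen V) :
    letI := sectionsAlgebra f V
    ∃ θ : TensorProduct K Γ(X, V) Γ(X, V) →+* Γ(pullback f f, squareOpens f V),
      Function.Surjective θ ∧
      (∀ a, θ (a ⊗ₜ 1) = (pullback.fst f f).appLE V (squareOpens f V) inf_le_left a) ∧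
      ∀ a, θ (1 ⊗ₜ a) = (pullback.snd f f).appLE V (squareOpens f V) inf_le_right a := by
  let := sectionsAlgebra f V
  have H := isPushout_squareOpens (f := f) hV
  let := (((pullback.fst f f).appLE V (squareOpens f V) inf_le_left).hom.comp
    (algebraMap K Γ(X, V))).toAlgebra
  let l : Γ(X, V) →ₐ[K] Γ(pullback f f, squareOpens f V) :=
    { ((pullback.fst f f).appLE V (squareOpens f V) inf_le_left).hom with commutes' := fun _ ↦ rfl }
  let r : Γ(X, V) →ₐ[K] Γ(pullback f f, squareOpens f V) :=
    { ((pullback.snd f f).appLE V (squareOpens f V) inf_le_right).hom with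
      commutes' := fun c ↦ by
        exact congr($(H.w.symm) ((Scheme.ΓSpecIso (.of K)).inv c)) }
  let θ := Algebra.TensorProduct.lift l r fun _ _ ↦ Commute.all _ _
  have hl (a) : θ (a ⊗ₜ 1) = (pullback.fst f f).appLE V (squareOpens f V) inf_le_left a := by
    simp [θ, l]
  have hr (a) : θ (1 ⊗ₜ a) = (pullback.snd f f).appLE V (squareOpens f V) inf_le_right a := by
    simp [θ, r]
  refine ⟨θ, ?_, hl, hr⟩
  rw [RingHom.coe_coe, ← AlgHom.coe_toRingHom, ← RingHom.range_eq_top, ← top_le_iff,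
    ← CommRingCat.closure_range_union_range_eq_top_of_isPushout H, Subring.closure_le]
  rintro _ (⟨a, rfl⟩ | ⟨a, rfl⟩)
  exacts [⟨_, hl a⟩, ⟨_, hr a⟩]

variable (f) [IsSeparated f] (n : ℕ)

/-- A power of the diagonal ideal has the diagonal as its support, closed by separatedness, and
there the two projections agree. So a point whose first projection lies in `V` lies over `V × V`. -/
lemma infinitesimalNbhd_preimage (V : X.Opens) : infinitesimalNbhdFst f n ⁻¹ᵁ V =
    IdealSheafData.subschemeι (diagonalIdeal f ^ (n + 1)) ⁻¹ᵁ squareOpens f V := by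
  refine le_antisymm (fun z hz ↦ ⟨hz, ?_⟩) fun z hz ↦ hz.1
  let q := IdealSheafData.subschemeι (diagonalIdeal f ^ (n + 1))
  obtain ⟨x, hx⟩ : q z ∈ Set.range (pullback.diagonal f) := by
    have h : q z ∈ (diagonalIdeal f ^ (n + 1)).support := by
      rw [← SetLike.mem_coe, ← IdealSheafData.range_subschemeι]
      exact ⟨z, rfl⟩
    rw [IdealSheafData.support_pow_succ] at h
    have h' := (Hom.support_ker (pullback.diagonal f)).le h
    rwa [← (pullback.diagonal f).isClosedEmbedding.isClosed_range.closure_eq]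
  change pullback.fst f f (q z) ∈ V at hz
  change pullback.snd f f (q z) ∈ V
  rw [← hx, ← Scheme.Hom.comp_apply] at hz ⊢
  simpa using hz

lemma appLE_eq_zero_of_mem_ker {V : X.Opens} (hV : IsAffineOpen V)
    (s : Γ(pullback f f, squareOpens f V))
    (hs : s ∈ (diagonalIdeal f).ideal ⟨_, isAffineOpen_squareOpens hV⟩ ^ (n + 1)) :
    (IdealSheafData.subschemeι (diagonalIdeal f ^ (n + 1))).appLE (squareOpens f V)
      (infinitesimalNbhdFst f n ⁻¹ᵁ V) (infinitesimalNbhd_preimage f n V).le s = 0 := by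
  replace hs := (IdealSheafData.ker_subschemeι_app (diagonalIdeal f ^ (n + 1))
    ⟨_, isAffineOpen_squareOpens hV⟩).ge hs
  exact (congrArg ((infinitesimalNbhd f n).presheaf.map
    (homOfLE (infinitesimalNbhd_preimage f n V).le).op) hs).trans (map_zero _)

lemma appLE_surjective {V : X.Opens} (hV : IsAffineOpen V) :
    Function.Surjective ((IdealSheafData.subschemeι (diagonalIdeal f ^ (n + 1))).appLE
      (squareOpens f V) (infinitesimalNbhdFst f n ⁻¹ᵁ V) (infinitesimalNbhd_preimage f n V).le) := by
  have h := IdealSheafData.subschemeι_app_surjective (diagonalIdeal f ^ (n + 1))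
    ⟨_, isAffineOpen_squareOpens hV⟩
  -- The open set is made a variable so that the equality of opens can be substituted in the types.
  have key (U : (infinitesimalNbhd f n).Opens) (e : U = IdealSheafData.subschemeι
      (diagonalIdeal f ^ (n + 1)) ⁻¹ᵁ squareOpens f V) : Function.Surjective
      ((IdealSheafData.subschemeι (diagonalIdeal f ^ (n + 1))).appLE (squareOpens f V) U e.le) := by
    subst e
    rw [Hom.appLE_eq_app]
    exact h
  exact key _ (infinitesimalNbhd_preimage f n V)

/-- Over an affine open, the sheaf of principal parts is a quotient of the module of principal parts
of the ring of sections. -/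
theorem exists_principalParts_surjective {V : X.Opens} (hV : IsAffineOpen V) :
    letI := sectionsAlgebra f V
    ∃ ψ : PrincipalParts K Γ(X, V) n →+* Γ(infinitesimalNbhd f n, infinitesimalNbhdFst f n ⁻¹ᵁ V),
      Function.Surjective ψ ∧
      ∀ a, ψ (PrincipalParts.tmul K n a 1) = (infinitesimalNbhdFst f n).app V a := by
  let := sectionsAlgebra f V
  obtain ⟨θ, hθ, hl, hr⟩ := exists_tensorProduct_squareOpens (f := f) hV
  let q := (IdealSheafData.subschemeι (diagonalIdeal f ^ (n + 1))).appLE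
    (squareOpens f V) (infinitesimalNbhdFst f n ⁻¹ᵁ V) (infinitesimalNbhd_preimage f n V).le
  -- A generator `1 ⊗ a - a ⊗ 1` goes to the difference of the two pullbacks of `a`, which vanishes
  -- on the diagonal.
  have hI : KaehlerDifferential.ideal K Γ(X, V) ≤
      ((diagonalIdeal f).ideal ⟨_, isAffineOpen_squareOpens hV⟩).comap θ := by
    rw [← KaehlerDifferential.span_range_eq_ideal, Ideal.span_le]
    rintro _ ⟨a, rfl⟩
    refine (Hom.ker_apply (pullback.diagonal f) ⟨_, isAffineOpen_squareOpens hV⟩).ge ?_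
    rw [RingHom.mem_ker, map_sub, hl, hr, map_sub, sub_eq_zero]
    have h1 := Hom.appLE_comp_appLE (pullback.diagonal f) (pullback.snd f f) V (squareOpens f V)
      (pullback.diagonal f ⁻¹ᵁ squareOpens f V) inf_le_right le_rfl
    have h2 := Hom.appLE_comp_appLE (pullback.diagonal f) (pullback.fst f f) V (squareOpens f V)
      (pullback.diagonal f ⁻¹ᵁ squareOpens f V) inf_le_left le_rfl
    have h3 := h1.trans (Eq.trans (by simp only [pullback.diagonal_fst, pullback.diagonal_snd]) h2.symm)
    rw [Hom.appLE_eq_app] at h3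
    exact congr($h3 a)
  refine ⟨Ideal.Quotient.lift _ (q.hom.comp θ) fun s hs ↦ appLE_eq_zero_of_mem_ker f n hV _ ?_,
    ?_, fun a ↦ ?_⟩
  · exact (Ideal.pow_right_mono hI (n + 1)).trans (Ideal.le_comap_pow θ (n + 1)) hs
  · exact Ideal.Quotient.lift_surjective_of_surjective _ _ ((appLE_surjective f n hV).comp hθ)
  · change q (θ (a ⊗ₜ 1)) = _
    rw [hl]
    have h := Hom.appLE_comp_appLE (IdealSheafData.subschemeι (diagonalIdeal f ^ (n + 1)))
      (pullback.fst f f) V (squareOpens f V) (infinitesimalNbhdFst f n ⁻¹ᵁ V) inf_le_left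
      (infinitesimalNbhd_preimage f n V).le
    exact congr($h a).trans congr($(Hom.appLE_eq_app (f := infinitesimalNbhdFst f n) (U := V)) a)

end Neighbourhood
end NashBlowup

/-! ### Sections of the Grassmannian near a point -/

namespace NashBlowup

open Scheme

/-- The points of `Spec` of the local ring are the generizations of `x`, so their images lie in
every open set containing `g x`, in particular in the range of `j`. -/
lemma exists_specMap_comp_eq {X Y : Scheme.{u}} {S : CommRingCat.{u}} (j : Spec S ⟶ Y)
    [IsOpenImmersion j] (g : X ⟶ Y) (x : X) (hx : g x ∈ Set.range j) :
    ∃ τ : S ⟶ X.presheaf.stalk x, Spec.map τ ≫ j = X.fromSpecStalk x ≫ g := by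
  have h : Set.range (X.fromSpecStalk x ≫ g) ⊆ Set.range j := by
    rintro _ ⟨y, rfl⟩
    have hy : X.fromSpecStalk x y ⤳ x := (range_fromSpecStalk (X := X) (x := x)).le ⟨y, rfl⟩
    rw [Scheme.Hom.comp_apply]
    exact (hy.map g.continuous).mem_open j.isOpenEmbedding.isOpen_range hx
  refine ⟨Spec.preimage (IsOpenImmersion.lift j _ h), ?_⟩
  rw [Spec.map_preimage, IsOpenImmersion.lift_fac]

lemma germ_eq_of_specMap_comp_fromSpec {X : Scheme.{u}} {V : X.Opens} (hV : IsAffineOpen V) {x : X}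
    (ρ : Γ(X, V) ⟶ X.presheaf.stalk x) (h : Spec.map ρ ≫ hV.fromSpec = X.fromSpecStalk x) :
    ∃ hx : x ∈ V, ρ = X.presheaf.germ V x hx := by
  have hx : x ∈ V := by
    rw [← SetLike.mem_coe, ← hV.range_fromSpec, ← fromSpecStalk_closedPoint (x := x), ← h]
    exact ⟨_, (Scheme.Hom.comp_apply _ _ _).symm⟩
  refine ⟨hx, Spec.map_injective ?_⟩
  rw [← cancel_mono hV.fromSpec, h, ← hV.fromSpecStalk_eq_fromSpecStalk hx]
  rfl

/-- A section of the Grassmannian of quotients of `p_* 𝒪_Z` gives, near each point, coordinates of a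
quotient of rank `r` with values in the local ring. -/
theorem exists_coordinates_of_section {X Z : Scheme.{u}} (p : Z ⟶ X) (r : ℕ) [QuasiCompact p]
    [QuasiSeparated p] (s : X ⟶ grassmannian p r) (hs : s ≫ grassmannianπ p r = 𝟙 X) (x : X) :
    ∃ (V : X.Opens) (_ : IsAffineOpen V) (hx : x ∈ V)
      (φ : Γ(Z, p ⁻¹ᵁ V) → Fin r → X.presheaf.stalk x),
      (∀ m m', φ (m + m') = φ m + φ m') ∧
      (∀ a m, φ (p.app V a * m) = X.presheaf.germ V x hx a • φ m) ∧
      ∀ j, Pi.single j 1 ∈ Set.range φ := by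
  obtain ⟨i, z, hz⟩ := IsLocallyDirected.ι_jointly_surjective
    (GrassmannianIndex.chartFunctor p r) (s x)
  have : IsOpenImmersion (chartι i) :=
    inferInstanceAs (IsOpenImmersion (colimit.ι (GrassmannianIndex.chartFunctor p r) i))
  obtain ⟨τ, hτ⟩ := exists_specMap_comp_eq (chartι i) s x ⟨z, hz⟩
  let ρ : Γ(X, i.V.toOpens) ⟶ X.presheaf.stalk x :=
    CommRingCat.ofHom (FrameRing.base (p.app i.V.toOpens).hom i.S) ≫ τ
  -- Because `s` is a section, the base ring of the chart acts on the local ring by taking germs.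
  obtain ⟨hx, hρ⟩ := germ_eq_of_specMap_comp_fromSpec i.V.2 ρ (by
    rw [Spec.map_comp, Category.assoc, ← chartι_π, reassoc_of% hτ, hs, Category.comp_id])
  -- Any tuple of the chart is a basis of the quotient; in the coordinates it defines, its own
  -- entries map to the standard basis.
  obtain ⟨g, hg⟩ := i.nonempty
  have H := FrameRing.isFrameSystem_comp τ.hom
  refine ⟨i.V.toOpens, i.V.2, hx, fun m t ↦ τ.hom (FrameRing.coord _ _ ⟨g, hg⟩ m t),
    fun m m' ↦ funext fun t ↦ H.map_add _ _ _ _, fun a m ↦ funext fun t ↦ ?_,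
    fun j ↦ ⟨g j, funext fun t ↦ ?_⟩⟩
  · exact (H.map_smul ⟨g, hg⟩ a m t).trans congr($hρ a * _)
  · exact (H.map_frame ⟨g, hg⟩ j t).trans (Pi.single_apply ..).symm

lemma ringKrullDim_le_topologicalKrullDim {X : Scheme.{u}} {V : X.Opens} (hV : IsAffineOpen V) :
    ringKrullDim Γ(X, V) ≤ topologicalKrullDim X := by
  rw [← PrimeSpectrum.topologicalKrullDim_eq_ringKrullDim]
  exact hV.fromSpec.isOpenEmbedding.isInducing.topologicalKrullDim_le

lemma finiteType_sectionsAlgebra {K : Type u} [Field K] {X : Scheme.{u}} (f : X ⟶ Spec (.of K))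
    [LocallyOfFiniteType f] {V : X.Opens} (hV : IsAffineOpen V) :
    letI := sectionsAlgebra f V
    Algebra.FiniteType K Γ(X, V) := by
  have h := f.finiteType_appLE (isAffineOpen_top _) hV le_top
  exact RingHom.FiniteType.comp h (RingHom.FiniteType.of_surjective _
    (ConcreteCategory.bijective_of_isIso (ΓSpecIso (.of K)).inv).2)

lemma germ_sectionsAlgebra {K : Type u} [Field K] {X : Scheme.{u}} (f : X ⟶ Spec (.of K))
    (V : X.Opens) (x : X) (hx : x ∈ V) :
    ((ΓSpecIso (.of K)).inv ≫ f.appLE ⊤ V le_top) ≫ X.presheaf.germ V x hx =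
      (ΓSpecIso (.of K)).inv ≫ f.appTop ≫ X.presheaf.germ ⊤ x trivial := by
  rw [Category.assoc]
  congr 1
  have h : f.appLE ⊤ V le_top = f.appTop ≫ X.presheaf.map (homOfLE le_top).op := rfl
  rw [h, Category.assoc, X.presheaf.germ_res]

end NashBlowup

end

/-! ### The theorem -/

theorem mainTheorem6 {K : Type u} [Field K] [IsAlgClosed K] (X : Scheme.{u})
    (f : X ⟶ Spec (.of K)) [AlgebraicGeometry.IsIntegral X] [IsSeparated f]
    [LocallyOfFiniteType f] [QuasiCompact f]
    (n d : ℕ) (hd : topologicalKrullDim X = d) (h : IsIso (NashBlowup.nashBlowupπ f n d)) (x : X) :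
    letI := NashBlowup.stalkAlgebra f x
    Nonempty (NashBlowup.PrincipalParts K (X.presheaf.stalk x) n ≃ₗ[X.presheaf.stalk x]
      (Fin ((n + d).choose d) → X.presheaf.stalk x) ×
        Submodule.torsion (X.presheaf.stalk x)
          (NashBlowup.PrincipalParts K (X.presheaf.stalk x) n)) := by
  obtain ⟨V, hV, hx, φ, hadd, hsmul, hframe⟩ := NashBlowup.exists_coordinates_of_section
    (NashBlowup.infinitesimalNbhdFst f n) ((n + d).choose d)
    -- The inverse of `π_n`, viewed in the Grassmannian, is a global section of its structure
    -- morphism.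
    (inv (NashBlowup.nashBlowupπ f n d) ≫
      Scheme.IdealSheafData.subschemeι (NashBlowup.nashIdeal f n d))
    ((Category.assoc _ _ _).trans (IsIso.inv_hom_id (NashBlowup.nashBlowupπ f n d))) x
  let := NashBlowup.stalkAlgebra f x
  let := NashBlowup.sectionsAlgebra f V
  have : Nonempty V := ⟨⟨x, hx⟩⟩
  obtain ⟨ψ, hψ, hψa⟩ := NashBlowup.exists_principalParts_surjective f n hV
  let : Algebra Γ(X, V) (X.presheaf.stalk x) := X.presheaf.algebra_section_stalk ⟨x, hx⟩
  have : IsScalarTower K Γ(X, V) (X.presheaf.stalk x) :=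
    .of_algebraMap_eq fun c ↦ congr($(NashBlowup.germ_sectionsAlgebra f V x hx) c).symm
  let : Algebra K X.functionField :=
    ((algebraMap (X.presheaf.stalk x) X.functionField).comp
      (algebraMap K (X.presheaf.stalk x))).toAlgebra
  have : IsScalarTower K (X.presheaf.stalk x) X.functionField := .of_algebraMap_eq fun _ ↦ rfl
  have : IsScalarTower Γ(X, V) (X.presheaf.stalk x) X.functionField :=
    functionField_isScalarTower X V ⟨x, hx⟩
  have : IsScalarTower K Γ(X, V) X.functionField := .of_algebraMap_eq fun c ↦ by
    rw [IsScalarTower.algebraMap_apply Γ(X, V) (X.presheaf.stalk x),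
      ← IsScalarTower.algebraMap_apply K Γ(X, V)]
    rfl
  have := functionField_isFractionRing_of_isAffineOpen X V hV
  have := NashBlowup.finiteType_sectionsAlgebra f hV
  have : IsLocalization (hV.primeIdealOf ⟨x, hx⟩).asIdeal.primeCompl (X.presheaf.stalk x) :=
    hV.isLocalization_stalk ⟨x, hx⟩
  refine NashBlowup.PrincipalParts.nonempty_linearEquiv_of_localization (A := Γ(X, V))
    (L := X.functionField) K n (hV.primeIdealOf ⟨x, hx⟩).asIdeal.primeCompl
    ((NashBlowup.ringKrullDim_le_topologicalKrullDim hV).trans hd.le)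
    -- The coordinates are pulled back to the principal parts of the ring of sections; they still
    -- reach the standard basis because `ψ` is surjective.
    { toFun := fun y ↦ φ (ψ y)
      map_add' := fun y y' ↦ by rw [map_add, hadd]
      map_smul' := fun a y ↦ by
        rw [NashBlowup.PrincipalParts.smul_eq_tmul_mul, map_mul, hψa, hsmul]
        rfl } fun j ↦ ?_
  obtain ⟨m, hm⟩ := hframe j
  obtain ⟨y, rfl⟩ := hψ m
  exact ⟨y, hm⟩
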